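/- \textbf{Setting.} Let $J\subset\mathbb R$ be open, $a:J\to\mathbb R\smallsetminus\{0\}$ smooth, and let $D$ be the Dirac operator of the Robertson--Walker metric $dt^2+a(t)^2\,d\sigma^2$ on $J\times\mathbb S^3$ in Hopf coordinates $x=(t,\eta,\phi_1,\phi_2)$, $0<\eta<\pi/2$, that is, the operator with symbol $q_1+q_0$, $$q_1=\begin{pmatrix}0&0&ie_4-e_1&ie_2+e_3\\0&0&ie_2-e_3&-e_1-ie_4\\-e_1-ie_4&-ie_2-e_3&0&0\\e_3-ie_2&ie_4-e_1&0&0\end{pmatrix},\qquad q_0=\begin{pmatrix}0&0&h&g\\0&0&g&h\\h&-g&0&0\\-g&h&0&0\end{pmatrix},$$ where $e_1=\xi_1$, $e_2=\xi_2/a(t)$, $e_3=\csc(\eta)\,\xi_3/a(t)$, $e_4=\sec(\eta)\,\xi_4/a(t)$, $h=\frac{3i\,a'(t)}{2a(t)}$, $g=\frac{\cot\eta-\tan\eta}{2a(t)}$. The symbol of $D^2$ is $p_2+p_1+p_0$ with $p_2=q_1^2$, $p_1=q_0q_1+q_1q_0-i\sum_{j=1}^4\partial_{\xi_j}q_1\,\partial_{x_j}q_1$,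 $p_0=q_0^2-i\sum_{j=1}^4\partial_{\xi_j}q_1\,\partial_{x_j}q_0$. The homogeneous parts of the symbol of the parametrix of $\Delta_4=D^2\otimes1+1\otimes\Delta_{\mathbb T^2}$ ($\Delta_{\mathbb T^2}$ the flat Laplacian, with symbol $\xi_5^2+\xi_6^2$) are $\sigma_{-2}=(p_2+(\xi_5^2+\xi_6^2)I)^{-1}$ and, for $n>0$, $$\sigma_{-2-n}=-\Big(\sum\frac{(-i)^{|\nu|}}{\nu!}\,(\partial_\xi^\nu\sigma_{-2-j})\,(\partial_x^\nu p_k)\Big)\sigma_{-2},$$ the sum being over $0\le j<n$, $0\le k\le2$, $\nu\in\mathbb Z_{\ge0}^4$ with $-2-j-|\nu|+k=-n$ (the $x$-derivatives of the torus term vanish). Let $b_{-6}(t,\eta,\xi_1,\dots,\xi_6)$ be obtained from $\mathrm{tr}(\sigma_{-6})$, $\xi\neq0$, by removing all terms with an odd power of some $\xi_j$ in the numerator, i.e. $b_{-6}$ is the part of $\mathrm{tr}(\sigma_{-6})$ that is even in each $\xi_j$. Put $\sigma_{\xi,5}=\sum_{j=1}^6(-1)^{j-1}\xi_j\,d\xi_1\wedge\cdots\widehat{d\xi_j}\cdots\wedge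 d\xi_6$, and introduce the coordinates $$u_0=\sin^2\eta,\quad u_1=\xi_1,\quad u_2=\xi_2,\quad u_3=\csc(\eta)\,\xi_3,\quad u_4=\sec(\eta)\,\xi_4,\quad u_5=\xi_5,\quad u_6=\xi_6,$$ the form $\widetilde\sigma_5=\frac12\sum_{j=1}^6(-1)^{j-1}u_j\,du_0\wedge du_1\wedge\cdots\widehat{du_j}\cdots\wedge du_6$, and $Q_{\alpha,4}=u_1^2+\alpha^{-2}(u_2^2+u_3^2+u_4^2)+u_5^2+u_6^2$. \textbf{Theorem.} There is a rational function $f=f_{(\alpha_1,\dots,\alpha_4)}(u_0,\dots,u_6,\alpha)$, independent of $a$, which is a finite $\mathbb Q$-linear combination of functions $$\frac{P(u_0,\dots,u_6,\alpha,\alpha_1,\dots,\alpha_4)}{\alpha^{2r}u_0^k(1-u_0)^mQ_{\alpha,4}^\ell},\qquad P\in\mathbb Q[u_0,\dots,u_6,\alpha,\alpha_1,\dots,\alpha_4],\quad r,k,m,\ell\in\mathbb Z_{\ge0},$$ such that the following holds. (1) For every $a$ as above, all $t\in J$, $0<\eta<\pi/2$, all $\phi_1,\phi_2$ and all $\xi\ne0$,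 the value of $b_{-6}$ is the value of $f$ at $(u_0,\dots,u_6)$, $\alpha=a(t)$, $\alpha_j=a^{(j)}(t)$ ($1\le j\le4$); and the form $b_{-6}\,d\eta\wedge\sigma_{\xi,5}$ in the variables $(\eta,\xi)$ (for fixed $t$) is the pull-back of $\Omega=f\,\widetilde\sigma_5$ under $(\eta,\xi)\mapsto(u_0,\dots,u_6)$. Moreover $\int_{|\xi|=1}b_{-6}=\int_{|\xi|=1}\mathrm{tr}(\sigma_{-6})$ for the surface measure of the unit sphere, so $b_{-6}$ computes the Wodzicki residue density of $\Delta_4^{-1}$, hence $a_4$. (2) For every field $K$ of characteristic zero (in particular $K=\mathbb Q$), every fixed $\alpha\in K\smallsetminus\{0\}$ and all parameters $(\alpha_1,\dots,\alpha_4)\in K^4$, the rational form $\Omega^\alpha_{(\alpha_1,\dots,\alpha_4)}=f\,\widetilde\sigma_5$ on $\mathbb A^7_K$ is a regular algebraic differential $6$-form on $\mathbb A^7\smallsetminus(\{Q_{\alpha,4}=0\}\cup\{u_0=0\}\cup\{u_0=1\})$. -/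

import Mathlib

open scoped ContDiff

namespace RobertsonWalker

/-! ### Symbols, and the Dirac operator of a Robertson-Walker metric

A base point is `x = (t, η, φ₁, φ₂)` (the translation-invariant torus directions carry no
coordinate), a covector is `ξ = (ξ₁, …, ξ₆)` with `ξ₁, …, ξ₄` dual to `x` and `ξ₅, ξ₆` dual to the
flat `2`-torus.  Indices start at `0` in the code. -/

/-- Matrix valued symbols. -/
abbrev Symb : Type := (Fin 4 → ℝ) → (Fin 6 → ℝ) → Matrix (Fin 4) (Fin 4) ℂ

/-- The entrywise partial derivative `∂F/∂x_j`. -/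
noncomputable def dX (j : Fin 4) (F : Symb) : Symb := fun x ξ =>
  Matrix.of fun p q => deriv (fun s : ℝ => F (Function.update x j s) ξ p q) (x j)

/-- The position among `ξ₁, …, ξ₆` of the covector coordinate dual to `x_j`. -/
def dual (j : Fin 4) : Fin 6 := Fin.castLE (by norm_num) j

/-- The entrywise partial derivative `∂F/∂ξ_j`, `j = 1, …, 4`. -/
noncomputable def dXi (j : Fin 4) (F : Symb) : Symb := fun x ξ =>
  Matrix.of fun p q =>
    deriv (fun s : ℝ => F x (Function.update ξ (dual j) s) p q) (ξ (dual j))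

/-- `∂_x^ν` for a multi-index `ν`. -/
noncomputable def dXMulti (ν : Fin 4 → ℕ) (F : Symb) : Symb :=
  (dX 0)^[ν 0] ((dX 1)^[ν 1] ((dX 2)^[ν 2] ((dX 3)^[ν 3] F)))

/-- `∂_ξ^ν` for a multi-index `ν`. -/
noncomputable def dXiMulti (ν : Fin 4 → ℕ) (F : Symb) : Symb :=
  (dXi 0)^[ν 0] ((dXi 1)^[ν 1] ((dXi 2)^[ν 2] ((dXi 3)^[ν 3] F)))

/-- `q₁`: the principal symbol of the Dirac operator `D` of `dt² + a(t)² dσ²` in Hopf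
coordinates. -/
noncomputable def q1 (a : ℝ → ℝ) : Symb := fun x ξ =>
  let e1 : ℂ := (ξ 0 : ℝ)
  let e2 : ℂ := (ξ 1 / a (x 0) : ℝ)
  let e3 : ℂ := (ξ 2 / (Real.sin (x 1) * a (x 0)) : ℝ)
  let e4 : ℂ := (ξ 3 / (Real.cos (x 1) * a (x 0)) : ℝ)
  !![0, 0, Complex.I * e4 - e1, Complex.I * e2 + e3;
     0, 0, Complex.I * e2 - e3, -e1 - Complex.I * e4;
     -e1 - Complex.I * e4, -Complex.I * e2 - e3, 0, 0;
     e3 - Complex.I * e2, Complex.I * e4 - e1, 0, 0]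

/-- `q₀`: the order zero part of the symbol of the Dirac operator `D`. -/
noncomputable def q0 (a : ℝ → ℝ) : Symb := fun x _ =>
  let h : ℂ := 3 * Complex.I * (deriv a (x 0) / (2 * a (x 0)) : ℝ)
  let g : ℂ := ((Real.cot (x 1) - Real.tan (x 1)) / (2 * a (x 0)) : ℝ)
  !![0, 0, h, g;
     0, 0, g, h;
     h, -g, 0, 0;
     -g, h, 0, 0]

/-- `p₂`: the part of order `2` of the symbol of `D²`. -/
noncomputable def p2 (a : ℝ → ℝ) : Symb := fun x ξ => q1 a x ξ * q1 a x ξ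

/-- `p₁`: the part of order `1` of the symbol of `D²`. -/
noncomputable def p1 (a : ℝ → ℝ) : Symb := fun x ξ =>
  q0 a x ξ * q1 a x ξ + q1 a x ξ * q0 a x ξ
    + ∑ j : Fin 4, (-Complex.I) • (dXi j (q1 a) x ξ * dX j (q1 a) x ξ)

/-- `p₀`: the part of order `0` of the symbol of `D²`. -/
noncomputable def p0 (a : ℝ → ℝ) : Symb := fun x ξ =>
  q0 a x ξ * q0 a x ξ + ∑ j : Fin 4, (-Complex.I) • (dXi j (q1 a) x ξ * dX j (q0 a) x ξ)

/-- The part of order `k = 0, 1, 2` of the symbol of `Δ₄ = D² ⊗ 1 + 1 ⊗ Δ_{𝕋²}`. -/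
noncomputable def symbDelta (a : ℝ → ℝ) : Fin 3 → Symb :=
  ![p0 a, p1 a,
    fun x ξ => p2 a x ξ + (((ξ 4) ^ 2 + (ξ 5) ^ 2 : ℝ) : ℂ) • (1 : Matrix (Fin 4) (Fin 4) ℂ)]

/-- `paramSymb a n` is `σ_{-2-n}(Δ₄⁻¹)`, the part of order `-2-n` of the symbol of the parametrix
of `Δ₄`.  For `n > 0` the sum runs over `0 ≤ j < n`, `0 ≤ k ≤ 2` and the multi-indices `ν` with
`-2 - j - |ν| + k = -n` (so that every `ν i` is at most `n`). -/
noncomputable def paramSymb (a : ℝ → ℝ) : ℕ → Symb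
  | 0 => fun x ξ => (symbDelta a 2 x ξ)⁻¹
  | n + 1 => fun x ξ =>
      -(∑ j : Fin (n + 1), ∑ k : Fin 3,
          ∑ ν ∈ (Fintype.piFinset fun _ : Fin 4 => Finset.range (n + 2)) with
              2 + (j : ℕ) + ∑ i, ν i = (n + 1) + (k : ℕ),
            ((-Complex.I) ^ (∑ i, ν i) / ((∏ i, (ν i).factorial : ℕ) : ℂ)) •
              (dXiMulti ν (paramSymb a j) x ξ * dXMulti ν (symbDelta a k) x ξ))
        * paramSymb a 0 x ξ
  decreasing_by all_goals omega

/-- `tr σ_{-6}(Δ₄⁻¹)`. -/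
noncomputable def trSymb (a : ℝ → ℝ) (x : Fin 4 → ℝ) (ξ : Fin 6 → ℝ) : ℂ :=
  (paramSymb a 4 x ξ).trace

/-- `b_{-6}`: what remains of `tr σ_{-6}(Δ₄⁻¹)` after all the terms with an odd power of some `ξ_j`
in the numerator have been removed, i.e. (the denominators being even in every `ξ_j`) the part
which is even in each of `ξ₁, …, ξ₆`. -/
noncomputable def b6 (a : ℝ → ℝ) (x : Fin 4 → ℝ) (ξ : Fin 6 → ℝ) : ℂ :=
  (1 / 64 : ℂ) * ∑ ε : Fin 6 → ℤˣ, trSymb a x fun i => (((ε i : ℤˣ) : ℤ) : ℝ) * ξ i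

/-- The integral of a function over the unit sphere `|ξ| = 1` of the cotangent fibre, with respect
to the surface measure. -/
noncomputable def sphereIntegral (F : (Fin 6 → ℝ) → ℂ) : ℂ :=
  ∫ v : Metric.sphere (0 : EuclideanSpace ℝ (Fin 6)) 1,
    F (fun i => (v : EuclideanSpace ℝ (Fin 6)) i)
      ∂(MeasureTheory.volume : MeasureTheory.Measure (EuclideanSpace ℝ (Fin 6))).toSphere

/-! ### Differential `6`-forms on `ℝ⁷` -/

/-- Differential `6`-forms on `ℝ⁷`, with complex values. -/
abbrev Form : Type := (Fin 7 → ℝ) → (Fin 7 → ℝ) [⋀^Fin 6]→ₗ[ℝ] ℂ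

/-- The constant form `dy_{s 0} ∧ ⋯ ∧ dy_{s 5}`. -/
noncomputable def dWedge (s : Fin 6 → Fin 7) : (Fin 7 → ℝ) [⋀^Fin 6]→ₗ[ℝ] ℂ :=
  Complex.ofRealCLM.toLinearMap.compAlternatingMap
    ((Matrix.detRowAlternating : (Fin 6 → ℝ) [⋀^Fin 6]→ₗ[ℝ] ℝ).compLinearMap
      (LinearMap.funLeft ℝ ℝ s))

/-- The form `∑_{j=1}^6 (-1)^{j-1} y_j dy₀ ∧ dy₁ ∧ ⋯ ∧ \widehat{dy_j} ∧ ⋯ ∧ dy₆`; in the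
coordinates `y = (η, ξ₁, …, ξ₆)` this is `dη ∧ σ_{ξ,5}`. -/
noncomputable def sphereForm : Form := fun y =>
  ∑ j : Fin 6, ((((-1) ^ (j : ℕ) * y j.succ : ℝ)) : ℂ) • dWedge j.succ.succAbove

/-- The form `σ̃₅` on the `u`-space. -/
noncomputable def sigmaTilde : Form := fun u => (1 / 2 : ℂ) • sphereForm u

/-- The change of coordinates `(η, ξ₁, …, ξ₆) ↦ (u₀, …, u₆)`. -/
noncomputable def uCoord (y : Fin 7 → ℝ) : Fin 7 → ℝ :=
  ![Real.sin (y 0) ^ 2, y 1, y 2, y 3 / Real.sin (y 0), y 4 / Real.cos (y 0), y 5, y 6]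

/-- The pull-back of a form under a map. -/
noncomputable def pullback (Φ : (Fin 7 → ℝ) → (Fin 7 → ℝ)) (θ : Form) : Form := fun y =>
  (θ (Φ y)).compLinearMap (fderiv ℝ Φ y).toLinearMap

/-- The form `b_{-6} · dη ∧ σ_{ξ,5}` in the coordinates `(η, ξ₁, …, ξ₆)`, at a fixed time `t` (and
at fixed angles `φ₁, φ₂`). -/
noncomputable def b6Form (a : ℝ → ℝ) (t φ₁ φ₂ : ℝ) : Form := fun y =>
  b6 a ![t, y 0, φ₁, φ₂] (Fin.tail y) • sphereForm y

/-! ### The rational functions -/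

/-- The polynomial variables `u₀, …, u₆`, `α` and `α₁, …, α₄`. -/
inductive Var : Type
  | u (i : Fin 7)
  | scale
  | param (j : Fin 4)

/-- The quadratic form `Q_{α,4} = u₁² + α⁻² (u₂² + u₃² + u₄²) + u₅² + u₆²`. -/
def quadric {K B : Type*} [Field K] [CommRing B] [Algebra K B] (α : K) (u : Fin 7 → B) : B :=
  u 1 ^ 2 + algebraMap K B ((α ^ 2)⁻¹) * (u 2 ^ 2 + u 3 ^ 2 + u 4 ^ 2) + u 5 ^ 2 + u 6 ^ 2

/-- The data of one summand `c · P / (α^{2r} u₀^k (1-u₀)^m Q_{α,4}^ℓ)`. -/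
structure RatTerm : Type where
  c : ℚ
  P : MvPolynomial Var ℚ
  r : ℕ
  k : ℕ
  m : ℕ
  ℓ : ℕ

/-- The value of a summand at `u` (in a field `B`, over a base field `K` of characteristic zero),
for the parameters `α` and `α₁, …, α₄` in `K`. -/
noncomputable def RatTerm.value {K B : Type*} [Field K] [CharZero K] [Field B] [Algebra K B]
    (T : RatTerm) (α : K) (β : Fin 4 → K) (u : Fin 7 → B) : B :=
  algebraMap K B (T.c : K) *
    (T.P.eval₂ ((algebraMap K B).comp (Rat.castHom K))
        (fun v => match v with
          | Var.u i => u i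
          | Var.scale => algebraMap K B α
          | Var.param j => algebraMap K B (β j)) /
      (algebraMap K B α ^ (2 * T.r) * u 0 ^ T.k * (1 - u 0) ^ T.m * quadric α u ^ T.ℓ))

/-- The value of the rational function `f = ∑ c · P / (α^{2r} u₀^k (1-u₀)^m Q_{α,4}^ℓ)`. -/
noncomputable def ratFun {K B : Type*} [Field K] [CharZero K] [Field B] [Algebra K B]
    (f : List RatTerm) (α : K) (β : Fin 4 → K) (u : Fin 7 → B) : B :=
  (f.map fun T => T.value α β u).sum

/-- The form `Ω^α_{(α₁,…,α₄)} = f σ̃₅` on the `u`-space (over `ℝ`). -/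
noncomputable def omegaForm (f : List RatTerm) (α : ℝ) (β : Fin 4 → ℝ) : Form := fun u =>
  ((ratFun f α β u : ℝ) : ℂ) • sigmaTilde u

/-! ### Algebraic differential forms on the complement of `\widehat{CZ}_α ∪ H₀ ∪ H₁` -/

/-- The polynomial `u₀ (1 - u₀) Q_{α,4}`, whose zero set is `\widehat{CZ}_α ∪ H₀ ∪ H₁`. -/
noncomputable def divisorPoly {K : Type*} [Field K] (α : K) : MvPolynomial (Fin 7) K :=
  MvPolynomial.X 0 * (1 - MvPolynomial.X 0) * quadric α (MvPolynomial.X : Fin 7 → _)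

/-- The coordinate ring of the affine variety `𝔸⁷ ∖ (\widehat{CZ}_α ∪ H₀ ∪ H₁)` over `K`. -/
abbrev CoordRing {K : Type*} [Field K] (α : K) : Type _ := Localization.Away (divisorPoly α)

theorem divisorPoly_ne_zero {K : Type*} [Field K] [CharZero K] (α : K) : divisorPoly α ≠ 0 := by
  intro h
  have h2 := congrArg (MvPolynomial.eval (![2, 1, 0, 0, 0, 0, 0] : Fin 7 → K)) h
  simp [divisorPoly, quadric, MvPolynomial.algebraMap_eq] at h2
  norm_num at h2

instance {K : Type*} [Field K] [CharZero K] (α : K) : IsDomain (CoordRing α) :=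
  IsLocalization.Away.isDomain (CoordRing α) (divisorPoly_ne_zero α)

/-- The function field of `𝔸⁷ ∖ (\widehat{CZ}_α ∪ H₀ ∪ H₁)`. -/
abbrev FunField {K : Type*} [Field K] [CharZero K] (α : K) : Type _ := FractionRing (CoordRing α)

/-- The coordinates `u₀, …, u₆` as elements of the function field. -/
noncomputable def uFun {K : Type*} [Field K] [CharZero K] (α : K) (i : Fin 7) : FunField α :=
  algebraMap (CoordRing α) (FunField α)
    (algebraMap (MvPolynomial (Fin 7) K) (CoordRing α) (MvPolynomial.X i))

/-- The algebraic (Kähler) form `σ̃₅` attached to `u₀, …, u₆ ∈ B`. -/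
noncomputable def sigmaTildeAlg (K : Type*) {B : Type*} [Field K] [CommRing B] [Algebra K B]
    (u : Fin 7 → B) : ⋀[B]^6 (Ω[B⁄K]) :=
  algebraMap K B (1 / 2) • ∑ j : Fin 6, ((-1) ^ (j : ℕ) * u j.succ) •
    exteriorPower.ιMulti B 6 fun i => KaehlerDifferential.D K B (u (j.succ.succAbove i))

/-- `(v₁, …, v₆) ↦ v₁ ∧ ⋯ ∧ v₆` on rational `1`-forms, with scalars restricted to regular
functions. -/
noncomputable def wedgeRational {K : Type*} [Field K] [CharZero K] (α : K) :
    (Ω[FunField α⁄K]) [⋀^Fin 6]→ₗ[CoordRing α] ⋀[FunField α]^6 (Ω[FunField α⁄K]) :=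
  { MultilinearMap.restrictScalars (CoordRing α)
      (exteriorPower.ιMulti (FunField α) 6 (M := Ω[FunField α⁄K])).toMultilinearMap with
    map_eq_zero_of_eq' := fun v _ _ h hij =>
      (exteriorPower.ιMulti (FunField α) 6 (M := Ω[FunField α⁄K])).map_eq_zero_of_eq v h hij }

/-- The map from regular `6`-forms on `𝔸⁷ ∖ (\widehat{CZ}_α ∪ H₀ ∪ H₁)` to rational `6`-forms,
`dv₁ ∧ ⋯ ∧ dv₆ ↦ dv₁ ∧ ⋯ ∧ dv₆`. -/
noncomputable def regularToRational {K : Type*} [Field K] [CharZero K] (α : K) :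
    ⋀[CoordRing α]^6 (Ω[CoordRing α⁄K]) →ₗ[CoordRing α] ⋀[FunField α]^6 (Ω[FunField α⁄K]) :=
  exteriorPower.alternatingMapLinearEquiv
    ((wedgeRational α).compLinearMap (KaehlerDifferential.map K K (CoordRing α) (FunField α)))

end RobertsonWalker

/-! Every symbol in the recursion is a matrix of polynomials in finitely many kinds of functions:
`i`, `1/a`, the derivatives of `a`, `cot η`, `tan η`, the rescaled covector `u` and `1/Q`. These
polynomials are closed under the derivatives in `t`, `η`, `ξ₁`, `ξ₂`. Nothing depends on `φ₁`, `φ₂`,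
so terms containing `∂_{ξ₃}` or `∂_{ξ₄}` are multiplied by zero. By the Clifford relations `q₁²` is
scalar, hence `σ_{-2} = 1/Q` and no other inverse occurs. The generators are kept as free variables
of a polynomial ring with derivations; relations such as `i² = -1` hold only after evaluation.

Three facts are carried through the recursion (`paramSymb_adm`). By weight, `σ_{-2-n}` involves no
derivative of `a` beyond order `n`. Complex conjugation acts on `σ_{-2-n}` as `(-1)^n` times
conjugation by a quaternionic structure. The reflection `η ↦ -η`, lifted to covectors, acts as
conjugation by a diagonal matrix. Hence `tr σ_{-6}` is real and reflection invariant.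

With `c = cot η` one has `c² = (1-u₀)/u₀` and `tan η = c u₀/(1-u₀)`, so a formal symbol takes values
`A + Bc + i(C + Dc)` with `A, B, C, D` of the required rational shape (`exists_splits`). Averaging
over the signs of the `ξ_j` absorbs the covector signs of the reflection, so the even part is
unchanged under `c ↦ -c`. Together with reality this leaves only `A`, which is `f`
(`exists_ratFun_evenPart`).

The form identity expresses that `dη ∧ σ_{ξ,5}` is, up to sign, the contraction of the volume form
with the Euler field in `ξ`: the change of coordinates has Jacobian determinant `2` and preserves
that field. The sphere integrals agree because sign changes are isometries. Regularity holds because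
all denominators of `f` are units on the complement of the divisor. -/

namespace RobertsonWalker

/-! ### The differential ring of formal symbols -/

/-- Generators of the ring of formal symbols: the imaginary unit, `1/a`, the derivatives of `a`,
`cot η`, `tan η`, the rescaled covectors and `1/Q`. -/
inductive Gen : Type
  | I
  | w
  | jet (j : ℕ)
  | ct
  | tn
  | u (j : Fin 6)
  | z

/-- The ring of formal symbols. -/
abbrev GPoly : Type := MvPolynomial Gen ℚ

/-- A generator as a formal symbol. -/
noncomputable abbrev gx (g : Gen) : GPoly := MvPolynomial.X g

/-- The highest derivative of `a` in a generator. -/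
def Gen.order : Gen → ℕ
  | .jet j => j
  | .w => 0
  | .I => 0
  | .ct => 0
  | .tn => 0
  | .u _ => 0
  | .z => 0

/-- Formal symbols which involve no derivative of `a` of order greater than `n`. -/
noncomputable def jetSub (n : ℕ) : Subalgebra ℚ GPoly :=
  Algebra.adjoin ℚ (MvPolynomial.X '' {g : Gen | g.order ≤ n})

theorem gx_mem {n : ℕ} {g : Gen} (h : g.order ≤ n) : gx g ∈ jetSub n :=
  Algebra.subset_adjoin ⟨g, h, rfl⟩

theorem jetSub_mono {m n : ℕ} (h : m ≤ n) : jetSub m ≤ jetSub n :=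
  Algebra.adjoin_mono (Set.image_mono fun _ hg => le_trans hg h)

theorem derivation_mem_jetSub {m n : ℕ} (hmn : m ≤ n) (D : Derivation ℚ GPoly GPoly)
    (hD : ∀ g : Gen, g.order ≤ m → D (gx g) ∈ jetSub n) {P : GPoly} (hP : P ∈ jetSub m) :
    D P ∈ jetSub n := by
  induction hP using Algebra.adjoin_induction with
  | mem x hx => obtain ⟨g, hg, rfl⟩ := hx; exact hD g hg
  | algebraMap r => rw [Derivation.map_algebraMap]; exact zero_mem _
  | add x y _ _ h1 h2 => rw [map_add]; exact add_mem h1 h2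
  | mul x y hx hy h1 h2 =>
    rw [Derivation.leibniz, smul_eq_mul, smul_eq_mul]
    exact add_mem (mul_mem (jetSub_mono hmn hx) h2) (mul_mem (jetSub_mono hmn hy) h1)

/-- `∂/∂t` on generators. -/
noncomputable def dtGen : Gen → GPoly
  | .I => 0
  | .w => -(gx .w ^ 2 * gx (.jet 1))
  | .jet j => gx (.jet (j + 1))
  | .ct => 0
  | .tn => 0
  | .u _ => 0
  | .z => gx .z ^ 2 * (2 * gx .w ^ 3 * gx (.jet 1)
      * (gx (.u 1) ^ 2 + gx (.u 2) ^ 2 + gx (.u 3) ^ 2))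

/-- `∂/∂η` on the rescaled covectors. -/
noncomputable def dEtaCov : Fin 6 → GPoly :=
  ![0, 0, -(gx .ct * gx (.u 2)), gx .tn * gx (.u 3), 0, 0]

/-- `∂/∂η` on generators. -/
noncomputable def dEtaGen : Gen → GPoly
  | .I => 0
  | .w => 0
  | .jet _ => 0
  | .ct => -(1 + gx .ct ^ 2)
  | .tn => 1 + gx .tn ^ 2
  | .u j => dEtaCov j
  | .z => gx .z ^ 2 * (2 * gx .w ^ 2
      * (gx .ct * gx (.u 2) ^ 2 - gx .tn * gx (.u 3) ^ 2))

/-- `∂/∂x_j` on formal symbols. -/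
noncomputable def derivX (j : Fin 4) : Derivation ℚ GPoly GPoly :=
  MvPolynomial.mkDerivation ℚ ((![dtGen, dEtaGen, fun _ => 0, fun _ => 0] : Fin 4 → Gen → GPoly) j)

/-- `∂/∂ξ₁` on generators. -/
noncomputable def dXi0Gen : Gen → GPoly
  | .u j => if j = 0 then 1 else 0
  | .z => -(gx .z ^ 2 * (2 * gx (.u 0)))
  | .I => 0
  | .w => 0
  | .jet _ => 0
  | .ct => 0
  | .tn => 0

/-- `∂/∂ξ₂` on generators. -/
noncomputable def dXi1Gen : Gen → GPoly
  | .u j => if j = 1 then 1 else 0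
  | .z => -(gx .z ^ 2 * (2 * gx .w ^ 2 * gx (.u 1)))
  | .I => 0
  | .w => 0
  | .jet _ => 0
  | .ct => 0
  | .tn => 0

/-- `∂/∂ξ₁` and `∂/∂ξ₂` on formal symbols. -/
noncomputable def derivXi (j : Fin 2) : Derivation ℚ GPoly GPoly :=
  MvPolynomial.mkDerivation ℚ ((![dXi0Gen, dXi1Gen] : Fin 2 → Gen → GPoly) j)

theorem derivX_zero_gx (g : Gen) : derivX 0 (gx g) = dtGen g := MvPolynomial.mkDerivation_X _ _ _

theorem derivX_one_gx (g : Gen) : derivX 1 (gx g) = dEtaGen g := MvPolynomial.mkDerivation_X _ _ _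

theorem derivXi_zero_gx (g : Gen) : derivXi 0 (gx g) = dXi0Gen g :=
  MvPolynomial.mkDerivation_X _ _ _

theorem derivXi_one_gx (g : Gen) : derivXi 1 (gx g) = dXi1Gen g :=
  MvPolynomial.mkDerivation_X _ _ _

theorem derivXi_mem {n : ℕ} (j : Fin 2) {P : GPoly} (hP : P ∈ jetSub n) :
    derivXi j P ∈ jetSub n := by
  refine derivation_mem_jetSub le_rfl _ (fun g hg => ?_) hP
  have hz : gx .z ∈ jetSub n := gx_mem (Nat.zero_le _)
  have hw : gx .w ∈ jetSub n := gx_mem (Nat.zero_le _)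
  have hu : ∀ j, gx (.u j) ∈ jetSub n := fun j => gx_mem (Nat.zero_le _)
  have h2 : (2 : GPoly) ∈ jetSub n := by exact_mod_cast (jetSub n).natCast_mem 2
  fin_cases j <;> cases g <;>
    simp only [derivXi, MvPolynomial.mkDerivation_X, dXi0Gen, dXi1Gen, Fin.zero_eta, Fin.mk_one,
      Matrix.cons_val_zero, Matrix.cons_val_one] <;>
    first
    | exact zero_mem _
    | (split_ifs <;> first | exact one_mem _ | exact zero_mem _)
    | exact neg_mem (mul_mem (pow_mem hz _) (mul_mem h2 (hu _)))
    | exact neg_mem (mul_mem (pow_mem hz _) (mul_mem (mul_mem h2 (pow_mem hw _)) (hu _)))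

theorem derivX_one_mem {n : ℕ} {P : GPoly} (hP : P ∈ jetSub n) :
    derivX 1 P ∈ jetSub n := by
  refine derivation_mem_jetSub le_rfl _ (fun g hg => ?_) hP
  have hz : gx .z ∈ jetSub n := gx_mem (Nat.zero_le _)
  have hw : gx .w ∈ jetSub n := gx_mem (Nat.zero_le _)
  have hc : gx .ct ∈ jetSub n := gx_mem (Nat.zero_le _)
  have ht : gx .tn ∈ jetSub n := gx_mem (Nat.zero_le _)
  have hu : ∀ j, gx (.u j) ∈ jetSub n := fun j => gx_mem (Nat.zero_le _)
  have h2 : (2 : GPoly) ∈ jetSub n := by exact_mod_cast (jetSub n).natCast_mem 2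
  cases g with
  | u j =>
    rw [derivX_one_gx, dEtaGen]
    fin_cases j <;>
      first
      | exact zero_mem _
      | exact neg_mem (mul_mem hc (hu _))
      | exact mul_mem ht (hu _)
  | _ =>
    rw [derivX_one_gx]
    first
    | exact zero_mem _
    | exact neg_mem (add_mem (one_mem _) (pow_mem hc _))
    | exact add_mem (one_mem _) (pow_mem ht _)
    | exact mul_mem (pow_mem hz _) (mul_mem (mul_mem h2 (pow_mem hw _))
        (sub_mem (mul_mem hc (pow_mem (hu _) _)) (mul_mem ht (pow_mem (hu _) _))))

theorem derivX_zero_mem {n : ℕ} {P : GPoly} (hP : P ∈ jetSub n) :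
    derivX 0 P ∈ jetSub (n + 1) := by
  refine derivation_mem_jetSub (Nat.le_succ n) _ (fun g hg => ?_) hP
  have hz : gx .z ∈ jetSub (n + 1) := gx_mem (Nat.zero_le _)
  have hw : gx .w ∈ jetSub (n + 1) := gx_mem (Nat.zero_le _)
  -- The derivatives of `w` and `z` bring in `a'`, which is allowed even for `n = 0` because the
  -- target is `n + 1`.
  have hj : gx (.jet 1) ∈ jetSub (n + 1) := gx_mem (Nat.succ_le_succ (Nat.zero_le _))
  have hu : ∀ j, gx (.u j) ∈ jetSub (n + 1) := fun j => gx_mem (Nat.zero_le _)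
  have h2 : (2 : GPoly) ∈ jetSub (n + 1) := by exact_mod_cast (jetSub (n + 1)).natCast_mem 2
  cases g with
  | jet j =>
    simp only [derivX, MvPolynomial.mkDerivation_X, dtGen, Matrix.cons_val_zero]
    exact gx_mem (Nat.succ_le_succ hg)
  | _ =>
    simp only [derivX, MvPolynomial.mkDerivation_X, dtGen, Matrix.cons_val_zero]
    first
    | exact zero_mem _
    | exact neg_mem (mul_mem (pow_mem hw _) hj)
    | exact mul_mem (pow_mem hz _) (mul_mem (mul_mem (mul_mem h2 (pow_mem hw _)) hj)
        (add_mem (add_mem (pow_mem (hu _) _) (pow_mem (hu _) _)) (pow_mem (hu _) _)))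

/-- No generator depends on the angles `φ₁`, `φ₂`. This is why formal derivatives in `ξ₃` and `ξ₄`
are never needed. -/
theorem derivX_eq_zero {j : Fin 4} (hj : j = 2 ∨ j = 3) (P : GPoly) : derivX j P = 0 := by
  have : derivX j = 0 := by
    apply MvPolynomial.derivation_ext
    rcases hj with rfl | rfl <;> intro i <;> simp [derivX, MvPolynomial.mkDerivation_X]
  simp [this]

/-! ### The two involutions -/

/-- Formal complex conjugation on generators. -/
noncomputable def conjGen : Gen → GPoly
  | .I => -gx .I
  | .w => gx .w
  | .jet j => gx (.jet j)
  | .ct => gx .ct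
  | .tn => gx .tn
  | .u j => gx (.u j)
  | .z => gx .z

/-- Formal complex conjugation. -/
noncomputable def conjHom : GPoly →ₐ[ℚ] GPoly := MvPolynomial.aeval conjGen

/-- The signs of the rescaled covectors under the reflection `η ↦ -η`. -/
def reflSign : Fin 6 → ℤ := ![1, -1, -1, 1, 1, 1]

/-- The formal reflection `η ↦ -η` on generators. -/
noncomputable def reflGen : Gen → GPoly
  | .I => gx .I
  | .w => gx .w
  | .jet j => gx (.jet j)
  | .ct => -gx .ct
  | .tn => -gx .tn
  | .u j => (reflSign j : GPoly) * gx (.u j)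
  | .z => gx .z

/-- The formal reflection `η ↦ -η`. -/
noncomputable def reflHom : GPoly →ₐ[ℚ] GPoly := MvPolynomial.aeval reflGen

theorem conjHom_gx (g : Gen) : conjHom (gx g) = conjGen g := MvPolynomial.aeval_X _ _

theorem reflHom_gx (g : Gen) : reflHom (gx g) = reflGen g := MvPolynomial.aeval_X _ _

/-- Both sides are derivations along `φ`, so agreement on generators suffices. -/
theorem algHom_derivation (φ : GPoly →ₐ[ℚ] GPoly) (D : Derivation ℚ GPoly GPoly) (c : ℤ)
    (h : ∀ g : Gen, φ (D (gx g)) = c * D (φ (gx g))) (P : GPoly) : φ (D P) = c * D (φ P) := by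
  induction P using MvPolynomial.induction_on with
  | C r =>
    have : φ (MvPolynomial.C r) = MvPolynomial.C r := φ.commutes r
    simp [this]
  | add P Q hP hQ => simp [hP, hQ, mul_add]
  | mul_X P g hP =>
    simp only [Derivation.leibniz, smul_eq_mul, map_add, map_mul, hP, h g]
    ring

theorem conjHom_derivXi (j : Fin 2) (P : GPoly) : conjHom (derivXi j P) = derivXi j (conjHom P) := by
  have := algHom_derivation conjHom (derivXi j) 1 (fun g => by
    fin_cases j <;> cases g <;>
      simp [derivXi, conjHom_gx, map_ofNat, conjGen, dXi0Gen, dXi1Gen, MvPolynomial.mkDerivation_X, apply_ite]) P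
  simpa using this

theorem conjHom_derivX (j : Fin 4) (P : GPoly) : conjHom (derivX j P) = derivX j (conjHom P) := by
  have := algHom_derivation conjHom (derivX j) 1 (fun g => by
    cases g with
    | u i => fin_cases j <;> fin_cases i <;>
        simp [derivX, conjHom_gx, conjGen, dtGen, dEtaGen, dEtaCov, MvPolynomial.mkDerivation_X]
    | _ => fin_cases j <;>
        simp [derivX, conjHom_gx, map_ofNat, conjGen, dtGen, dEtaGen, MvPolynomial.mkDerivation_X]) P
  simpa using this

theorem reflHom_derivXi (j : Fin 2) (P : GPoly) :
    reflHom (derivXi j P) = ((-1) ^ (j : ℕ) : ℤ) * derivXi j (reflHom P) := by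
  refine algHom_derivation reflHom (derivXi j) _ (fun g => ?_) P
  cases g with
  | u i => fin_cases j <;> fin_cases i <;>
      simp [derivXi, reflHom_gx, reflGen, reflSign, dXi0Gen, dXi1Gen, MvPolynomial.mkDerivation_X]
  | _ => fin_cases j <;>
      simp [derivXi, reflHom_gx, map_ofNat, reflGen, reflSign, dXi0Gen, dXi1Gen,
        MvPolynomial.mkDerivation_X]

/-- Only `∂/∂η` (`j = 1`) truly changes sign; for `j = 2, 3` the derivation is zero and the sign is
immaterial. -/
theorem reflHom_derivX (j : Fin 4) (P : GPoly) :
    reflHom (derivX j P) = ((-1) ^ (j : ℕ) : ℤ) * derivX j (reflHom P) := by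
  refine algHom_derivation reflHom (derivX j) _ (fun g => ?_) P
  cases g with
  | u i => fin_cases j <;> fin_cases i <;>
      simp [derivX, reflHom_gx, reflGen, reflSign, dtGen, dEtaGen, dEtaCov,
        MvPolynomial.mkDerivation_X]
  | _ => fin_cases j <;>
      simp [derivX, reflHom_gx, map_ofNat, reflGen, reflSign, dtGen, dEtaGen, MvPolynomial.mkDerivation_X] <;>
      ring

/-! ### Evaluation of formal symbols -/

/-- The quadratic form `Q` in terms of the rescaled covector. -/
noncomputable def quadVal (α : ℝ) (v : Fin 6 → ℝ) : ℝ :=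
  v 0 ^ 2 + (α⁻¹) ^ 2 * (v 1 ^ 2 + v 2 ^ 2 + v 3 ^ 2) + v 4 ^ 2 + v 5 ^ 2

/-- Values of the generators. -/
noncomputable def genVal (β : ℕ → ℝ) (c s : ℝ) (v : Fin 6 → ℝ) : Gen → ℂ
  | .I => Complex.I
  | .w => ((β 0)⁻¹ : ℝ)
  | .jet j => β j
  | .ct => c
  | .tn => s
  | .u j => v j
  | .z => ((quadVal (β 0) v)⁻¹ : ℝ)

/-- The rescaled covector `(ξ₁, ξ₂, csc η ξ₃, sec η ξ₄, ξ₅, ξ₆)`. -/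
noncomputable def rescale (η : ℝ) (ξ : Fin 6 → ℝ) : Fin 6 → ℝ :=
  ![ξ 0, ξ 1, ξ 2 / Real.sin η, ξ 3 / Real.cos η, ξ 4, ξ 5]

/-- The values of the generators at a point of the cotangent bundle. -/
noncomputable def pointVal (a : ℝ → ℝ) (x : Fin 4 → ℝ) (ξ : Fin 6 → ℝ) : Gen → ℂ :=
  genVal (fun j => iteratedDeriv j a (x 0)) (Real.cot (x 1)) (Real.tan (x 1)) (rescale (x 1) ξ)

/-- Evaluation of formal symbols at a point of the cotangent bundle. -/
noncomputable def evalAt (a : ℝ → ℝ) (x : Fin 4 → ℝ) (ξ : Fin 6 → ℝ) : GPoly →ₐ[ℚ] ℂ :=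
  MvPolynomial.aeval (pointVal a x ξ)

theorem evalAt_gx (a : ℝ → ℝ) (x : Fin 4 → ℝ) (ξ : Fin 6 → ℝ) (g : Gen) :
    evalAt a x ξ (gx g) = pointVal a x ξ g := MvPolynomial.aeval_X _ _

/-- Smooth nowhere vanishing scale factors on an open set. -/
structure IsScale (J : Set ℝ) (a : ℝ → ℝ) : Prop where
  isOpen : IsOpen J
  smooth : ContDiffOn ℝ ∞ a J
  ne_zero : ∀ t ∈ J, a t ≠ 0

/-- The points of the punctured cotangent bundle over the coordinate patch. -/
structure InPatch (J : Set ℝ) (x : Fin 4 → ℝ) (ξ : Fin 6 → ℝ) : Prop where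
  time : x 0 ∈ J
  angle : x 1 ∈ Set.Ioo 0 (Real.pi / 2)
  cov : ξ ≠ 0

theorem InPatch.sin_pos {J : Set ℝ} {x : Fin 4 → ℝ} {ξ : Fin 6 → ℝ} (h : InPatch J x ξ) :
    0 < Real.sin (x 1) :=
  Real.sin_pos_of_pos_of_lt_pi h.angle.1 (by linarith [h.angle.2, Real.pi_pos])

theorem InPatch.cos_pos {J : Set ℝ} {x : Fin 4 → ℝ} {ξ : Fin 6 → ℝ} (h : InPatch J x ξ) :
    0 < Real.cos (x 1) :=
  Real.cos_pos_of_mem_Ioo ⟨by linarith [h.angle.1, Real.pi_pos], h.angle.2⟩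

theorem quadVal_ne_zero {α : ℝ} (hα : α ≠ 0) {v : Fin 6 → ℝ} (hv : v ≠ 0) :
    quadVal α v ≠ 0 := by
  intro h
  apply hv
  have hp : 0 < (α⁻¹) ^ 2 := by positivity
  rw [quadVal, mul_add, mul_add] at h
  have e1 := mul_nonneg hp.le (sq_nonneg (v 1))
  have e2 := mul_nonneg hp.le (sq_nonneg (v 2))
  have e3 := mul_nonneg hp.le (sq_nonneg (v 3))
  have e0 := sq_nonneg (v 0)
  have e4 := sq_nonneg (v 4)
  have e5 := sq_nonneg (v 5)
  have z1 : (α⁻¹) ^ 2 * v 1 ^ 2 = 0 := by linarith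
  have z2 : (α⁻¹) ^ 2 * v 2 ^ 2 = 0 := by linarith
  have z3 : (α⁻¹) ^ 2 * v 3 ^ 2 = 0 := by linarith
  have z0 : v 0 ^ 2 = 0 := by linarith
  have z4 : v 4 ^ 2 = 0 := by linarith
  have z5 : v 5 ^ 2 = 0 := by linarith
  simp only [mul_eq_zero, hp.ne', false_or] at z1 z2 z3
  funext i
  fin_cases i
  · exact pow_eq_zero_iff two_ne_zero |>.1 z0
  · exact pow_eq_zero_iff two_ne_zero |>.1 z1
  · exact pow_eq_zero_iff two_ne_zero |>.1 z2
  · exact pow_eq_zero_iff two_ne_zero |>.1 z3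
  · exact pow_eq_zero_iff two_ne_zero |>.1 z4
  · exact pow_eq_zero_iff two_ne_zero |>.1 z5

theorem rescale_ne_zero {η : ℝ} (hs : Real.sin η ≠ 0) (hc : Real.cos η ≠ 0) {ξ : Fin 6 → ℝ}
    (hξ : ξ ≠ 0) : rescale η ξ ≠ 0 := by
  intro h
  apply hξ
  funext i
  have hi := congrFun h i
  fin_cases i <;> simpa [rescale, hs, hc] using hi

theorem InPatch.quadVal_ne_zero {J : Set ℝ} {a : ℝ → ℝ} (ha : IsScale J a) {x : Fin 4 → ℝ}
    {ξ : Fin 6 → ℝ} (h : InPatch J x ξ) : quadVal (a (x 0)) (rescale (x 1) ξ) ≠ 0 :=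
  RobertsonWalker.quadVal_ne_zero (ha.ne_zero _ h.time)
    (rescale_ne_zero h.sin_pos.ne' h.cos_pos.ne' h.cov)

/-! ### Differentiation of evaluations -/

/-- The bridge from algebra to analysis: by the product rule, a formal derivation computes an actual
derivative as soon as it does so on the generators. -/
theorem hasDerivAt_aeval {γ : ℝ → Gen → ℂ} {r : ℝ} (D : Derivation ℚ GPoly GPoly)
    (h : ∀ g, HasDerivAt (fun s => γ s g) (MvPolynomial.aeval (γ r) (D (gx g))) r) (P : GPoly) :
    HasDerivAt (fun s => MvPolynomial.aeval (γ s) P) (MvPolynomial.aeval (γ r) (D P)) r := by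
  induction P using MvPolynomial.induction_on with
  | C q =>
    have e : D (MvPolynomial.C q) = 0 := MvPolynomial.derivation_C D q
    simp only [e, map_zero, MvPolynomial.aeval_C]
    exact hasDerivAt_const _ _
  | add P Q hP hQ => simpa using hP.fun_add hQ
  | mul_X P g hP =>
    simp only [Derivation.leibniz, smul_eq_mul, map_add, map_mul, MvPolynomial.aeval_X]
    exact (hP.fun_mul (h g)).congr_deriv (by ring)

theorem hasDerivAt_iteratedDeriv {J : Set ℝ} {a : ℝ → ℝ} (ha : IsScale J a) (j : ℕ) {t : ℝ}
    (ht : t ∈ J) : HasDerivAt (iteratedDeriv j a) (iteratedDeriv (j + 1) a t) t := by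
  -- Smoothness is known only on `J`; on an open set the derivatives within `J` are the ordinary
  -- ones.
  have h : DifferentiableOn ℝ (iteratedDerivWithin j a J) J :=
    ha.smooth.differentiableOn_iteratedDerivWithin (by exact_mod_cast ENat.natCast_lt_top j)
      ha.isOpen.uniqueDiffOn
  have h2 : DifferentiableOn ℝ (iteratedDeriv j a) J :=
    h.congr fun s hs => (iteratedDerivWithin_of_isOpen ha.isOpen hs).symm
  rw [iteratedDeriv_succ]
  exact (h2.differentiableAt (ha.isOpen.mem_nhds ht)).hasDerivAt

theorem hasDerivAt_cot {η : ℝ} (h : Real.sin η ≠ 0) :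
    HasDerivAt Real.cot (-(1 + Real.cot η ^ 2)) η := by
  have e : Real.cot = fun x => Real.cos x / Real.sin x := funext Real.cot_eq_cos_div_sin
  rw [e]
  refine ((Real.hasDerivAt_cos η).fun_div (Real.hasDerivAt_sin η) h).congr_deriv ?_
  field_simp
  ring

theorem hasDerivAt_tan_sq {η : ℝ} (h : Real.cos η ≠ 0) :
    HasDerivAt Real.tan (1 + Real.tan η ^ 2) η := by
  refine (Real.hasDerivAt_tan h).congr_deriv ?_
  rw [Real.tan_eq_sin_div_cos]
  field_simp
  linarith [Real.sin_sq_add_cos_sq η]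

theorem hasDerivAt_ofReal_inv {q : ℝ → ℝ} {q' r : ℝ} (hq : HasDerivAt q q' r) (h : q r ≠ 0) :
    HasDerivAt (fun s => (((q s)⁻¹ : ℝ) : ℂ)) (-((((q r)⁻¹ : ℝ) : ℂ) ^ 2 * q')) r := by
  refine (hq.fun_inv h).ofReal_comp.congr_deriv ?_
  push_cast
  ring

theorem hasDerivAt_pointVal_time {J : Set ℝ} {a : ℝ → ℝ} (ha : IsScale J a) {x : Fin 4 → ℝ}
    {ξ : Fin 6 → ℝ} (h : InPatch J x ξ) (g : Gen) :
    HasDerivAt (fun s => pointVal a (Function.update x 0 s) ξ g)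
      (evalAt a x ξ (derivX 0 (gx g))) (x 0) := by
  have hj := fun j => hasDerivAt_iteratedDeriv ha j h.time
  have hne : iteratedDeriv 0 a (x 0) ≠ 0 := by simpa using ha.ne_zero _ h.time
  rw [derivX_zero_gx]
  cases g with
  | jet j =>
    simp only [pointVal, genVal, dtGen, evalAt_gx, Function.update_self]
    exact (hj j).ofReal_comp
  | w =>
    simp only [pointVal, genVal, dtGen, evalAt_gx, Function.update_self, map_neg, map_mul, map_pow]
    exact hasDerivAt_ofReal_inv (hj 0) hne
  | z =>
    have hq := ((((((hj 0).fun_inv hne).fun_pow 2).mul_const (rescale (x 1) ξ 1 ^ 2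
      + rescale (x 1) ξ 2 ^ 2 + rescale (x 1) ξ 3 ^ 2)).const_add (rescale (x 1) ξ 0 ^ 2)).add_const
      (rescale (x 1) ξ 4 ^ 2)).add_const (rescale (x 1) ξ 5 ^ 2)
    refine (hasDerivAt_ofReal_inv hq (by simpa [quadVal] using h.quadVal_ne_zero ha)).congr_deriv ?_
    simp only [dtGen, evalAt_gx, map_mul, map_pow, map_add, map_ofNat, pointVal, genVal,
      quadVal]
    push_cast
    ring
  | _ =>
    simp [dtGen, pointVal, genVal, hasDerivAt_const]

theorem hasDerivAt_pointVal_angle {J : Set ℝ} {a : ℝ → ℝ} (ha : IsScale J a) {x : Fin 4 → ℝ}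
    {ξ : Fin 6 → ℝ} (h : InPatch J x ξ) (g : Gen) :
    HasDerivAt (fun s => pointVal a (Function.update x 1 s) ξ g)
      (evalAt a x ξ (derivX 1 (gx g))) (x 1) := by
  have h2 : HasDerivAt (fun s => ξ 2 / Real.sin s)
      (-(Real.cot (x 1) * (ξ 2 / Real.sin (x 1)))) (x 1) := by
    refine ((hasDerivAt_const (x 1) (ξ 2)).fun_div (Real.hasDerivAt_sin (x 1))
      h.sin_pos.ne').congr_deriv ?_
    rw [Real.cot_eq_cos_div_sin]
    have := h.sin_pos.ne'
    field_simp
    ring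
  have h3 : HasDerivAt (fun s => ξ 3 / Real.cos s)
      (Real.tan (x 1) * (ξ 3 / Real.cos (x 1))) (x 1) := by
    refine ((hasDerivAt_const (x 1) (ξ 3)).fun_div (Real.hasDerivAt_cos (x 1))
      h.cos_pos.ne').congr_deriv ?_
    rw [Real.tan_eq_sin_div_cos]
    have := h.cos_pos.ne'
    field_simp
    ring
  rw [derivX_one_gx]
  cases g with
  | ct =>
    refine (hasDerivAt_cot h.sin_pos.ne').ofReal_comp.congr_deriv ?_
    simp [dEtaGen, evalAt_gx, pointVal, genVal]
  | tn =>
    refine (hasDerivAt_tan_sq h.cos_pos.ne').ofReal_comp.congr_deriv ?_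
    simp [dEtaGen, evalAt_gx, pointVal, genVal]
  | u j =>
    fin_cases j
    · simp [pointVal, genVal, dEtaGen, dEtaCov, rescale, hasDerivAt_const]
    · simp [pointVal, genVal, dEtaGen, dEtaCov, rescale, hasDerivAt_const]
    · refine h2.ofReal_comp.congr_deriv ?_
      simp [dEtaGen, dEtaCov, evalAt_gx, pointVal, genVal, rescale]
    · refine h3.ofReal_comp.congr_deriv ?_
      simp [dEtaGen, dEtaCov, evalAt_gx, pointVal, genVal, rescale]
    · simp [pointVal, genVal, dEtaGen, dEtaCov, rescale, hasDerivAt_const]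
    · simp [pointVal, genVal, dEtaGen, dEtaCov, rescale, hasDerivAt_const]
  | z =>
    have hq := ((((((h2.fun_pow 2).const_add (ξ 1 ^ 2)).fun_add (h3.fun_pow 2)).const_mul
      (((iteratedDeriv 0 a (x 0))⁻¹) ^ 2)).const_add (ξ 0 ^ 2)).add_const
      (ξ 4 ^ 2)).add_const (ξ 5 ^ 2)
    refine (hasDerivAt_ofReal_inv hq
      (by simpa [quadVal, rescale] using h.quadVal_ne_zero ha)).congr_deriv ?_
    simp only [dEtaGen, evalAt_gx, map_mul, map_pow, map_sub, map_ofNat, pointVal,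
      genVal, quadVal, rescale, Matrix.cons_val]
    push_cast
    ring
  | _ =>
    simp [dEtaGen, pointVal, genVal, hasDerivAt_const]

theorem hasDerivAt_pointVal_cov_zero {J : Set ℝ} {a : ℝ → ℝ} (ha : IsScale J a) {x : Fin 4 → ℝ}
    {ξ : Fin 6 → ℝ} (h : InPatch J x ξ) (g : Gen) :
    HasDerivAt (fun s => pointVal a x (Function.update ξ 0 s) g)
      (evalAt a x ξ (derivXi 0 (gx g))) (ξ 0) := by
  rw [derivXi_zero_gx]
  cases g with
  | u i =>
    fin_cases i
    · simpa [pointVal, genVal, dXi0Gen, rescale] using (hasDerivAt_id (ξ 0)).ofReal_comp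
    all_goals simp [pointVal, genVal, dXi0Gen, rescale, hasDerivAt_const]
  | z =>
    have hq := ((((hasDerivAt_id' (ξ 0)).fun_pow 2).add_const
      (((iteratedDeriv 0 a (x 0))⁻¹) ^ 2 * (ξ 1 ^ 2 + (ξ 2 / Real.sin (x 1)) ^ 2
        + (ξ 3 / Real.cos (x 1)) ^ 2))).add_const (ξ 4 ^ 2)).add_const (ξ 5 ^ 2)
    refine (hasDerivAt_ofReal_inv hq
      (by simpa [quadVal, rescale] using h.quadVal_ne_zero ha)).congr_deriv ?_
    simp only [dXi0Gen, evalAt_gx, map_neg, map_mul, map_pow, map_ofNat, pointVal,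
      genVal, quadVal, rescale, Matrix.cons_val]
    push_cast
    ring
  | _ =>
    simp only [dXi0Gen, map_zero]
    exact hasDerivAt_const _ _

theorem hasDerivAt_pointVal_cov_one {J : Set ℝ} {a : ℝ → ℝ} (ha : IsScale J a) {x : Fin 4 → ℝ}
    {ξ : Fin 6 → ℝ} (h : InPatch J x ξ) (g : Gen) :
    HasDerivAt (fun s => pointVal a x (Function.update ξ 1 s) g)
      (evalAt a x ξ (derivXi 1 (gx g))) (ξ 1) := by
  rw [derivXi_one_gx]
  cases g with
  | u i =>
    fin_cases i
    · simp [pointVal, genVal, dXi1Gen, rescale, hasDerivAt_const]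
    · simpa [pointVal, genVal, dXi1Gen, rescale] using (hasDerivAt_id (ξ 1)).ofReal_comp
    all_goals simp [pointVal, genVal, dXi1Gen, rescale, hasDerivAt_const]
  | z =>
    have hq := (((((((hasDerivAt_id' (ξ 1)).fun_pow 2).add_const
      ((ξ 2 / Real.sin (x 1)) ^ 2)).add_const ((ξ 3 / Real.cos (x 1)) ^ 2)).const_mul
      (((iteratedDeriv 0 a (x 0))⁻¹) ^ 2)).const_add (ξ 0 ^ 2)).add_const
      (ξ 4 ^ 2)).add_const (ξ 5 ^ 2)
    refine (hasDerivAt_ofReal_inv hq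
      (by simpa [quadVal, rescale] using h.quadVal_ne_zero ha)).congr_deriv ?_
    simp only [dXi1Gen, evalAt_gx, map_neg, map_mul, map_pow, map_ofNat, pointVal,
      genVal, quadVal, rescale, Matrix.cons_val]
    push_cast
    ring
  | _ =>
    simp only [dXi1Gen, map_zero]
    exact hasDerivAt_const _ _

theorem hasDerivAt_evalAt_x {J : Set ℝ} {a : ℝ → ℝ} (ha : IsScale J a) {x : Fin 4 → ℝ}
    {ξ : Fin 6 → ℝ} (h : InPatch J x ξ) (j : Fin 4) (P : GPoly) :
    HasDerivAt (fun s => evalAt a (Function.update x j s) ξ P)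
      (evalAt a x ξ (derivX j P)) (x j) := by
  have key := hasDerivAt_aeval (γ := fun s => pointVal a (Function.update x j s) ξ) (r := x j)
    (derivX j) (fun g => by
      rw [Function.update_eq_self]
      rcases (by decide +revert : j = 0 ∨ j = 1 ∨ j = 2 ∨ j = 3) with rfl | rfl | rfl | rfl
      · exact hasDerivAt_pointVal_time ha h g
      · exact hasDerivAt_pointVal_angle ha h g
      · rw [derivX_eq_zero (Or.inl rfl), map_zero]
        simp [pointVal, hasDerivAt_const]
      · rw [derivX_eq_zero (Or.inr rfl), map_zero]
        simp [pointVal, hasDerivAt_const]) P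
  rwa [Function.update_eq_self] at key

theorem hasDerivAt_evalAt_xi {J : Set ℝ} {a : ℝ → ℝ} (ha : IsScale J a) {x : Fin 4 → ℝ}
    {ξ : Fin 6 → ℝ} (h : InPatch J x ξ) (j : Fin 2) (P : GPoly) :
    HasDerivAt (fun s => evalAt a x (Function.update ξ (Fin.castLE (by norm_num) j) s) P)
      (evalAt a x ξ (derivXi j P)) (ξ (Fin.castLE (by norm_num) j)) := by
  have key := hasDerivAt_aeval
    (γ := fun s => pointVal a x (Function.update ξ (Fin.castLE (by norm_num) j) s))
    (r := ξ (Fin.castLE (by norm_num) j)) (derivXi j) (fun g => by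
      rw [Function.update_eq_self]
      rcases (by decide +revert : j = 0 ∨ j = 1) with rfl | rfl
      · exact hasDerivAt_pointVal_cov_zero ha h g
      · exact hasDerivAt_pointVal_cov_one ha h g) P
  rwa [Function.update_eq_self] at key

/-- Representations by formal symbols hold only on the patch; its openness along coordinate lines
lets them be differentiated. -/
theorem InPatch.eventually_x {J : Set ℝ} (hJ : IsOpen J) {x : Fin 4 → ℝ} {ξ : Fin 6 → ℝ}
    (h : InPatch J x ξ) (j : Fin 4) :
    ∀ᶠ s in nhds (x j), InPatch J (Function.update x j s) ξ := by
  have hc : Continuous fun s => Function.update x j s := continuous_const.update j continuous_id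
  have h0 : ∀ᶠ s in nhds (x j), Function.update x j s 0 ∈ J :=
    ((continuous_apply 0).comp hc).continuousAt.eventually_mem
      (hJ.mem_nhds (by simpa using h.time))
  have h1 : ∀ᶠ s in nhds (x j), Function.update x j s 1 ∈ Set.Ioo 0 (Real.pi / 2) :=
    ((continuous_apply 1).comp hc).continuousAt.eventually_mem
      (isOpen_Ioo.mem_nhds (by simpa using h.angle))
  filter_upwards [h0, h1] with s e0 e1 using ⟨e0, e1, h.cov⟩

theorem InPatch.eventually_xi {J : Set ℝ} {x : Fin 4 → ℝ} {ξ : Fin 6 → ℝ}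
    (h : InPatch J x ξ) (j : Fin 6) :
    ∀ᶠ s in nhds (ξ j), InPatch J x (Function.update ξ j s) := by
  have hc : Continuous fun s => Function.update ξ j s := continuous_const.update j continuous_id
  have h0 : ∀ᶠ s in nhds (ξ j), Function.update ξ j s ∈ ({0}ᶜ : Set (Fin 6 → ℝ)) :=
    hc.continuousAt.eventually_mem (isOpen_compl_singleton.mem_nhds (by simpa using h.cov))
  filter_upwards [h0] with s e0 using ⟨h.time, h.angle, e0⟩

/-! ### Symbols which are represented by formal symbols -/

/-- Matrices of formal symbols. -/
abbrev FMat : Type := Matrix (Fin 4) (Fin 4) GPoly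

/-- A family of symbols is represented by a matrix of formal symbols. -/
def Rep (F : (ℝ → ℝ) → Symb) (X : FMat) : Prop :=
  ∀ (J : Set ℝ) (a : ℝ → ℝ), IsScale J a → ∀ x ξ, InPatch J x ξ →
    F a x ξ = X.map (evalAt a x ξ)

/-- An integral matrix as a matrix of formal symbols. -/
noncomputable def intMat (S : Matrix (Fin 4) (Fin 4) ℤ) : FMat := S.map (Int.castRingHom GPoly)

/-- The homomorphism `φ` acts on `X` as `d` times a conjugation. -/
def Twisted (φ : GPoly →ₐ[ℚ] GPoly) (S S' : Matrix (Fin 4) (Fin 4) ℤ) (d : ℤ) (X : FMat) : Prop :=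
  X.map φ = (d : GPoly) • (intMat S * X * intMat S')

theorem intMat_mul {S S' : Matrix (Fin 4) (Fin 4) ℤ} (h : S' * S = 1) :
    intMat S' * intMat S = 1 := by
  have := congrArg (fun A => A.map (Int.castRingHom GPoly)) h
  rwa [Matrix.map_mul, Matrix.map_one _ (map_zero _) (map_one _)] at this

theorem conj_mul_conj {M : Type*} [Monoid M] {A B : M} (h : B * A = 1) (X Y : M) :
    A * X * B * (A * Y * B) = A * (X * Y) * B := by
  calc A * X * B * (A * Y * B) = A * X * (B * A) * Y * B := by simp only [mul_assoc]
    _ = A * (X * Y) * B := by rw [h, mul_one, mul_assoc A X Y]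

theorem Twisted.mul {φ : GPoly →ₐ[ℚ] GPoly} {S S' : Matrix (Fin 4) (Fin 4) ℤ} (h : S' * S = 1)
    {d d' : ℤ} {X Y : FMat} (hX : Twisted φ S S' d X) (hY : Twisted φ S S' d' Y) :
    Twisted φ S S' (d * d') (X * Y) := by
  rw [Twisted, Matrix.map_mul, hX, hY, Matrix.smul_mul, Matrix.mul_smul, smul_smul, Int.cast_mul,
    conj_mul_conj (intMat_mul h)]

theorem Twisted.add {φ : GPoly →ₐ[ℚ] GPoly} {S S' : Matrix (Fin 4) (Fin 4) ℤ}
    {d : ℤ} {X Y : FMat} (hX : Twisted φ S S' d X) (hY : Twisted φ S S' d Y) :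
    Twisted φ S S' d (X + Y) := by
  rw [Twisted, Matrix.map_add _ (map_add φ), hX, hY, Matrix.mul_add, Matrix.add_mul, smul_add]

theorem Twisted.smul {φ : GPoly →ₐ[ℚ] GPoly} {S S' : Matrix (Fin 4) (Fin 4) ℤ}
    {d c : ℤ} {X : FMat} {P : GPoly} (hP : φ P = c * P) (hX : Twisted φ S S' d X) :
    Twisted φ S S' (c * d) (P • X) := by
  have : (P • X).map φ = φ P • X.map φ := by ext p q; simp
  rw [Twisted, this, hX, hP, Matrix.mul_smul, Matrix.smul_mul, smul_smul, smul_smul, Int.cast_mul]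
  congr 1
  ring

/-- Integral matrices are constants for `D`, so twisting by them is compatible with differentiation.
-/
theorem map_derivation_mul (D : Derivation ℚ GPoly GPoly) (S S' : Matrix (Fin 4) (Fin 4) ℤ)
    (X : FMat) :
    (intMat S * X * intMat S').map D = intMat S * X.map D * intMat S' := by
  ext p q
  simp [intMat, Matrix.mul_apply, Derivation.leibniz, mul_comm]

theorem Twisted.derivation {φ : GPoly →ₐ[ℚ] GPoly} {S S' : Matrix (Fin 4) (Fin 4) ℤ}
    {d c : ℤ} {X : FMat} {D : Derivation ℚ GPoly GPoly} (hD : ∀ P, φ (D P) = c * D (φ P))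
    (hX : Twisted φ S S' d X) : Twisted φ S S' (c * d) (X.map D) := by
  have h1 : (X.map D).map φ = (c : GPoly) • (X.map φ).map D := by
    ext p q : 1
    simp [hD]
  have h2 : ((d : GPoly) • (intMat S * X * intMat S')).map D
      = (d : GPoly) • (intMat S * X * intMat S').map D := by
    ext p q : 1
    simp [Derivation.leibniz]
  rw [Twisted, h1, hX, h2, map_derivation_mul, smul_smul, Int.cast_mul]

/-- The matrix of the quaternionic structure. -/
def structMat : Matrix (Fin 4) (Fin 4) ℤ :=
  !![0, 1, 0, 0; -1, 0, 0, 0; 0, 0, 0, 1; 0, 0, -1, 0]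

/-- The matrix which implements the reflection `η ↦ -η` on spinors. -/
def reflMat : Matrix (Fin 4) (Fin 4) ℤ :=
  !![1, 0, 0, 0; 0, -1, 0, 0; 0, 0, 1, 0; 0, 0, 0, -1]

theorem structMat_mul : (-structMat) * structMat = 1 := by decide

theorem reflMat_mul : reflMat * reflMat = 1 := by decide

/-- A family of symbols is represented by a matrix of formal symbols of weight `n`, with sign `d`
under conjugation and sign `e` under reflection. -/
def Adm (n : ℕ) (d e : ℤ) (F : (ℝ → ℝ) → Symb) : Prop :=
  ∃ X : FMat, (∀ p q, X p q ∈ jetSub n) ∧ Twisted conjHom structMat (-structMat) d X ∧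
    Twisted reflHom reflMat reflMat e X ∧ Rep F X

theorem Rep.add {F G : (ℝ → ℝ) → Symb} {X Y : FMat} (hF : Rep F X) (hG : Rep G Y) :
    Rep (fun a x ξ => F a x ξ + G a x ξ) (X + Y) := fun J a ha x ξ h => by
  simp only [hF J a ha x ξ h, hG J a ha x ξ h, Matrix.map_add _ (map_add _)]

theorem Rep.mul {F G : (ℝ → ℝ) → Symb} {X Y : FMat} (hF : Rep F X) (hG : Rep G Y) :
    Rep (fun a x ξ => F a x ξ * G a x ξ) (X * Y) := fun J a ha x ξ h => by
  simp only [hF J a ha x ξ h, hG J a ha x ξ h, Matrix.map_mul]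

theorem Rep.smul {F : (ℝ → ℝ) → Symb} {X : FMat} {P : GPoly} {c : ℂ} (hF : Rep F X)
    (hP : ∀ a x ξ, evalAt a x ξ P = c) :
    Rep (fun a x ξ => c • F a x ξ) (P • X) := fun J a ha x ξ h => by
  simp only [hF J a ha x ξ h]
  ext p q
  simp [hP]

theorem Rep.dX {F : (ℝ → ℝ) → Symb} {X : FMat} (hF : Rep F X) (j : Fin 4) :
    Rep (fun a => dX j (F a)) (X.map (derivX j)) := fun J a ha x ξ h => by
  ext p q
  have he : (fun s => F a (Function.update x j s) ξ p q)
      =ᶠ[nhds (x j)] fun s => evalAt a (Function.update x j s) ξ (X p q) := by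
    filter_upwards [h.eventually_x ha.isOpen j] with s hs
    rw [hF J a ha _ ξ hs, Matrix.map_apply]
  change deriv _ _ = _
  rw [he.deriv_eq, (hasDerivAt_evalAt_x ha h j (X p q)).deriv]
  rfl

theorem Rep.dXi {F : (ℝ → ℝ) → Symb} {X : FMat} (hF : Rep F X) (j : Fin 2) :
    Rep (fun a => dXi (Fin.castLE (by norm_num) j) (F a)) (X.map (derivXi j)) :=
  fun J a ha x ξ h => by
  ext p q
  have he : (fun s => F a x (Function.update ξ (Fin.castLE (by norm_num) j) s) p q)
      =ᶠ[nhds (ξ (Fin.castLE (by norm_num) j))] fun s =>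
        evalAt a x (Function.update ξ (Fin.castLE (by norm_num) j) s) (X p q) := by
    filter_upwards [h.eventually_xi (Fin.castLE (by norm_num) j)] with s hs
    rw [hF J a ha x _ hs, Matrix.map_apply]
  change deriv (fun s => F a x (Function.update ξ (Fin.castLE (by norm_num) j) s) p q)
    (ξ (Fin.castLE (by norm_num) j)) = _
  rw [he.deriv_eq, (hasDerivAt_evalAt_xi ha h j (X p q)).deriv]
  rfl

theorem Rep.iterate_dX {F : (ℝ → ℝ) → Symb} {X : FMat} (hF : Rep F X) (j : Fin 4) (m : ℕ) :
    Rep (fun a => (RobertsonWalker.dX j)^[m] (F a)) ((fun Y => Y.map (derivX j))^[m] X) := by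
  induction m with
  | zero => exact hF
  | succ m ih => simpa only [Function.iterate_succ_apply'] using ih.dX j

theorem Rep.iterate_dX_of_zero {F : (ℝ → ℝ) → Symb} (hF : Rep F 0) (j : Fin 4) (m : ℕ) :
    Rep (fun a => (RobertsonWalker.dX j)^[m] (F a)) 0 := by
  induction m with
  | zero => exact hF
  | succ m ih =>
    simp only [Function.iterate_succ_apply']
    have := ih.dX j
    rwa [Matrix.map_zero _ (map_zero _)] at this

theorem Rep.iterate_dX_angle {F : (ℝ → ℝ) → Symb} {X : FMat} (hF : Rep F X) {j : Fin 4}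
    (hj : j = 2 ∨ j = 3) {m : ℕ} (hm : m ≠ 0) :
    Rep (fun a => (RobertsonWalker.dX j)^[m] (F a)) 0 := by
  obtain ⟨k, rfl⟩ := Nat.exists_eq_succ_of_ne_zero hm
  have := (hF.iterate_dX j k).dX j
  simp only [Function.iterate_succ_apply']
  convert this using 1
  ext p q : 1
  simp [derivX_eq_zero hj]

/-- Disposes of every term of the recursion that contains a derivative in `ξ₃` or `ξ₄`, whatever the
other factor is. -/
theorem Rep.dXMulti_eq_zero {F : (ℝ → ℝ) → Symb} {X : FMat} (hF : Rep F X) {ν : Fin 4 → ℕ}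
    (hν : ν 2 ≠ 0 ∨ ν 3 ≠ 0) : Rep (fun a => dXMulti ν (F a)) 0 := by
  have key : Rep (fun a => (RobertsonWalker.dX 2)^[ν 2] ((RobertsonWalker.dX 3)^[ν 3] (F a))) 0 := by
    by_cases h3 : ν 3 = 0
    · exact (hF.iterate_dX 3 (ν 3)).iterate_dX_angle (Or.inl rfl) (by tauto)
    · exact (hF.iterate_dX_angle (Or.inr rfl) h3).iterate_dX_of_zero 2 _
  exact (key.iterate_dX_of_zero 1 _).iterate_dX_of_zero 0 _

theorem Adm.congr {n : ℕ} {d e : ℤ} {F G : (ℝ → ℝ) → Symb} (hF : Adm n d e F)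
    (h : ∀ a, F a = G a) : Adm n d e G := by
  obtain rfl : F = G := funext h
  exact hF

theorem Adm.of_rep_zero {F : (ℝ → ℝ) → Symb} (hF : Rep F 0) (n : ℕ) (d e : ℤ) : Adm n d e F :=
  ⟨0, fun _ _ => zero_mem _, by simp [Twisted], by simp [Twisted], hF⟩

theorem rep_zero : Rep (fun _ _ _ => 0) 0 := fun _ _ _ _ _ _ => by simp

theorem Adm.add {n : ℕ} {d e : ℤ} {F G : (ℝ → ℝ) → Symb} (hF : Adm n d e F) (hG : Adm n d e G) :
    Adm n d e (fun a x ξ => F a x ξ + G a x ξ) := by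
  obtain ⟨X, h1, h2, h3, h4⟩ := hF
  obtain ⟨Y, g1, g2, g3, g4⟩ := hG
  exact ⟨X + Y, fun p q => add_mem (h1 p q) (g1 p q), h2.add g2, h3.add g3, h4.add g4⟩

theorem Adm.sum {ι : Type*} {n : ℕ} {d e : ℤ} {F : ι → (ℝ → ℝ) → Symb} (s : Finset ι)
    (hF : ∀ i ∈ s, Adm n d e (F i)) : Adm n d e (fun a x ξ => ∑ i ∈ s, F i a x ξ) := by
  classical
  induction s using Finset.induction_on with
  | empty => simpa using Adm.of_rep_zero rep_zero n d e
  | insert i s hi ih =>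
    simp only [Finset.sum_insert hi]
    exact (hF i (Finset.mem_insert_self _ _)).add
      (ih fun k hk => hF k (Finset.mem_insert_of_mem hk))

theorem jetSub_mul_apply {m n : ℕ} {X Y : FMat} (hX : ∀ p q, X p q ∈ jetSub m)
    (hY : ∀ p q, Y p q ∈ jetSub n) (p q : Fin 4) : (X * Y) p q ∈ jetSub (m + n) := by
  rw [Matrix.mul_apply]
  exact sum_mem fun r _ => mul_mem (jetSub_mono (Nat.le_add_right _ _) (hX p r))
    (jetSub_mono (Nat.le_add_left _ _) (hY r q))

theorem Adm.mul {m n : ℕ} {d e d' e' : ℤ} {F G : (ℝ → ℝ) → Symb} (hF : Adm m d e F)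
    (hG : Adm n d' e' G) :
    Adm (m + n) (d * d') (e * e') (fun a x ξ => F a x ξ * G a x ξ) := by
  obtain ⟨X, h1, h2, h3, h4⟩ := hF
  obtain ⟨Y, g1, g2, g3, g4⟩ := hG
  exact ⟨X * Y, jetSub_mul_apply h1 g1, h2.mul structMat_mul g2, h3.mul reflMat_mul g3, h4.mul g4⟩

theorem Adm.smul {n : ℕ} {d e c c' : ℤ} {F : (ℝ → ℝ) → Symb} (hF : Adm n d e F) {P : GPoly}
    {z : ℂ} (hP : ∀ a x ξ, evalAt a x ξ P = z) (hn : P ∈ jetSub n)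
    (h1 : conjHom P = c * P) (h2 : reflHom P = c' * P) :
    Adm n (c * d) (c' * e) (fun a x ξ => z • F a x ξ) := by
  obtain ⟨X, g1, g2, g3, g4⟩ := hF
  exact ⟨P • X, fun p q => mul_mem hn (g1 p q), g2.smul h1, g3.smul h2, g4.smul hP⟩

/-- Each factor `-i` contributes a sign under conjugation and none under reflection; `k` stands for
the factorials `ν!`. -/
theorem Adm.smul_I_pow {n : ℕ} {d e : ℤ} {F : (ℝ → ℝ) → Symb} (hF : Adm n d e F) (m k : ℕ) :
    Adm n ((-1) ^ m * d) e (fun a x ξ => ((-Complex.I) ^ m / (k : ℂ)) • F a x ξ) := by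
  have hI : gx .I ∈ jetSub n := gx_mem (Nat.zero_le _)
  have := hF.smul (P := MvPolynomial.C (k : ℚ)⁻¹ * (-gx .I) ^ m) (c := (-1) ^ m) (c' := 1)
    (z := (-Complex.I) ^ m / (k : ℂ)) (fun a x ξ => ?_) ?_ ?_ ?_
  · simpa using this
  · rw [map_mul, map_pow, map_neg, evalAt_gx, evalAt, MvPolynomial.aeval_C]
    simp [pointVal, genVal, div_eq_mul_inv, mul_comm]
  · exact mul_mem ((jetSub n).algebraMap_mem _) (pow_mem (neg_mem hI) _)
  · have hC : conjHom (MvPolynomial.C (k : ℚ)⁻¹) = MvPolynomial.C (k : ℚ)⁻¹ := conjHom.commutes _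
    rw [map_mul, map_pow, map_neg, conjHom_gx, hC]
    simp only [conjGen]
    rw [neg_pow (-gx Gen.I)]
    push_cast
    ring
  · have hC : reflHom (MvPolynomial.C (k : ℚ)⁻¹) = MvPolynomial.C (k : ℚ)⁻¹ := reflHom.commutes _
    rw [map_mul, map_pow, map_neg, reflHom_gx, hC]
    simp [reflGen]

theorem Adm.dX_zero {n : ℕ} {d e : ℤ} {F : (ℝ → ℝ) → Symb} (hF : Adm n d e F) :
    Adm (n + 1) d e (fun a => dX 0 (F a)) := by
  obtain ⟨X, h1, h2, h3, h4⟩ := hF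
  refine ⟨X.map (derivX 0), fun p q => derivX_zero_mem (h1 p q), ?_, ?_, h4.dX 0⟩
  · simpa using h2.derivation (c := 1) (D := derivX 0) (by simp [conjHom_derivX])
  · simpa using h3.derivation (c := 1) (D := derivX 0) (by simp [reflHom_derivX])

theorem Adm.dX_one {n : ℕ} {d e : ℤ} {F : (ℝ → ℝ) → Symb} (hF : Adm n d e F) :
    Adm (n + 1) d (-e) (fun a => dX 1 (F a)) := by
  obtain ⟨X, h1, h2, h3, h4⟩ := hF
  -- `∂/∂η` creates no derivative of `a`; the weight is loosened so that `∂/∂t` and `∂/∂η` both cost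
  -- one.
  refine ⟨X.map (derivX 1), fun p q => jetSub_mono (Nat.le_succ n) (derivX_one_mem (h1 p q)), ?_, ?_,
    h4.dX 1⟩
  · simpa using h2.derivation (c := 1) (D := derivX 1) (by simp [conjHom_derivX])
  · simpa using h3.derivation (c := -1) (D := derivX 1) (by simp [reflHom_derivX])

theorem Adm.dXi_zero {n : ℕ} {d e : ℤ} {F : (ℝ → ℝ) → Symb} (hF : Adm n d e F) :
    Adm n d e (fun a => dXi 0 (F a)) := by
  obtain ⟨X, h1, h2, h3, h4⟩ := hF
  refine ⟨X.map (derivXi 0), fun p q => derivXi_mem 0 (h1 p q), ?_, ?_, h4.dXi 0⟩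
  · simpa using h2.derivation (c := 1) (D := derivXi 0) (by simp [conjHom_derivXi])
  · simpa using h3.derivation (c := 1) (D := derivXi 0) (by simp [reflHom_derivXi])

theorem Adm.dXi_one {n : ℕ} {d e : ℤ} {F : (ℝ → ℝ) → Symb} (hF : Adm n d e F) :
    Adm n d (-e) (fun a => dXi 1 (F a)) := by
  obtain ⟨X, h1, h2, h3, h4⟩ := hF
  refine ⟨X.map (derivXi 1), fun p q => derivXi_mem 1 (h1 p q), ?_, ?_, h4.dXi 1⟩
  · simpa using h2.derivation (c := 1) (D := derivXi 1) (by simp [conjHom_derivXi])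
  · simpa using h3.derivation (c := -1) (D := derivXi 1) (by simp [reflHom_derivXi])

theorem Adm.dXMulti {n : ℕ} {d e : ℤ} {F : (ℝ → ℝ) → Symb} (hF : Adm n d e F) {ν : Fin 4 → ℕ}
    (h2 : ν 2 = 0) (h3 : ν 3 = 0) :
    Adm (n + ν 0 + ν 1) d ((-1) ^ ν 1 * e) (fun a => dXMulti ν (F a)) := by
  have k1 : ∀ m, Adm (n + m) d ((-1) ^ m * e) (fun a => (dX 1)^[m] (F a)) := fun m => by
    induction m with
    | zero => simpa using hF
    | succ m ih =>
      simp only [Function.iterate_succ_apply']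
      rw [show (-1) ^ (m + 1) * e = -((-1) ^ m * e) by ring]
      exact ih.dX_one
  have k0 : ∀ m, Adm (n + ν 1 + m) d ((-1) ^ ν 1 * e)
      (fun a => (dX 0)^[m] ((dX 1)^[ν 1] (F a))) := fun m => by
    induction m with
    | zero => exact k1 _
    | succ m ih => simpa only [Function.iterate_succ_apply', ← Nat.add_assoc] using ih.dX_zero
  have := k0 (ν 0)
  simp only [RobertsonWalker.dXMulti, h2, h3, Function.iterate_zero, id]
  rwa [Nat.add_right_comm] at this

theorem Adm.dXiMulti {n : ℕ} {d e : ℤ} {F : (ℝ → ℝ) → Symb} (hF : Adm n d e F) {ν : Fin 4 → ℕ}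
    (h2 : ν 2 = 0) (h3 : ν 3 = 0) :
    Adm n d ((-1) ^ ν 1 * e) (fun a => dXiMulti ν (F a)) := by
  have k1 : ∀ m, Adm n d ((-1) ^ m * e) (fun a => (dXi 1)^[m] (F a)) := fun m => by
    induction m with
    | zero => simpa using hF
    | succ m ih =>
      simp only [Function.iterate_succ_apply']
      rw [show (-1) ^ (m + 1) * e = -((-1) ^ m * e) by ring]
      exact ih.dXi_one
  have k0 : ∀ m, Adm n d ((-1) ^ ν 1 * e)
      (fun a => (dXi 0)^[m] ((dXi 1)^[ν 1] (F a))) := fun m => by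
    induction m with
    | zero => exact k1 _
    | succ m ih => simpa only [Function.iterate_succ_apply'] using ih.dXi_zero
  simpa only [RobertsonWalker.dXiMulti, h2, h3, Function.iterate_zero, id] using k0 (ν 0)

theorem Adm.dXMulti_eq_zero {n : ℕ} {d e : ℤ} {F : (ℝ → ℝ) → Symb} (hF : Adm n d e F)
    {ν : Fin 4 → ℕ} (hν : ν 2 ≠ 0 ∨ ν 3 ≠ 0) : Rep (fun a => RobertsonWalker.dXMulti ν (F a)) 0 := by
  obtain ⟨X, -, -, -, h⟩ := hF
  exact h.dXMulti_eq_zero hν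

/-! ### The symbols of `D`, `D²` and of the parametrix -/

/-- The matrix of formal symbols which represents `q₁`. -/
noncomputable def q1Mat : FMat :=
  let e1 := gx (.u 0)
  let e2 := gx .w * gx (.u 1)
  let e3 := gx .w * gx (.u 2)
  let e4 := gx .w * gx (.u 3)
  !![0, 0, gx .I * e4 - e1, gx .I * e2 + e3;
     0, 0, gx .I * e2 - e3, -e1 - gx .I * e4;
     -e1 - gx .I * e4, -(gx .I * e2) - e3, 0, 0;
     e3 - gx .I * e2, gx .I * e4 - e1, 0, 0]

/-- The matrix of formal symbols which represents `q₀`. -/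
noncomputable def q0Mat : FMat :=
  let h := MvPolynomial.C (3 / 2) * (gx .I * gx (.jet 1) * gx .w)
  let g := MvPolynomial.C (1 / 2) * ((gx .ct - gx .tn) * gx .w)
  !![0, 0, h, g;
     0, 0, g, h;
     h, -g, 0, 0;
     -g, h, 0, 0]

/-- The quaternionic structure turns `i` into `-i` in the Clifford matrices. The reflection changes
the signs of `e₂` and `e₃`, which are exactly the entries whose sign conjugation by
`diag(1,-1,1,-1)` changes. -/
theorem q1_adm : Adm 0 1 1 q1 := by
  refine ⟨q1Mat, ?_, ?_, ?_, ?_⟩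
  · have hI : gx .I ∈ jetSub 0 := gx_mem le_rfl
    have hw : gx .w ∈ jetSub 0 := gx_mem le_rfl
    have hu : ∀ j, gx (.u j) ∈ jetSub 0 := fun j => gx_mem le_rfl
    have he : ∀ j, gx .w * gx (.u j) ∈ jetSub 0 := fun j => mul_mem hw (hu j)
    have hi : ∀ j, gx .I * (gx .w * gx (.u j)) ∈ jetSub 0 := fun j => mul_mem hI (he j)
    intro p q
    fin_cases p <;> fin_cases q <;> simp only [q1Mat, Fin.zero_eta, Fin.mk_one, Fin.reduceFinMk,
      Matrix.cons_val, Matrix.of_apply] <;> with_reducible first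
      | exact zero_mem _
      | exact sub_mem (hi _) (hu _)
      | exact add_mem (hi _) (he _)
      | exact sub_mem (hi _) (he _)
      | exact sub_mem (neg_mem (hu _)) (hi _)
      | exact sub_mem (neg_mem (hi _)) (he _)
      | exact sub_mem (he _) (hi _)
  · ext p q : 1
    fin_cases p <;> fin_cases q <;>
      simp [q1Mat, intMat, structMat, Matrix.mul_apply, Fin.sum_univ_four, conjHom_gx, conjGen] <;>
      ring
  · ext p q : 1
    fin_cases p <;> fin_cases q <;>
      simp [q1Mat, intMat, reflMat, Matrix.mul_apply, Fin.sum_univ_four, reflHom_gx, reflGen,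
        reflSign] <;>
      ring
  · intro J a ha x ξ h
    have hs := h.sin_pos.ne'
    have hc := h.cos_pos.ne'
    ext p q
    fin_cases p <;> fin_cases q <;>
      simp [q1, q1Mat, evalAt_gx, pointVal, genVal, rescale] <;>
      field_simp

/-- The sign `-1` arises because conjugation negates `h` and fixes `g`, while the quaternionic
structure does the opposite. -/
theorem q0_adm : Adm 1 (-1) 1 q0 := by
  refine ⟨q0Mat, ?_, ?_, ?_, ?_⟩
  · have hh : MvPolynomial.C (3 / 2) * (gx .I * gx (.jet 1) * gx .w) ∈ jetSub 1 :=
      mul_mem ((jetSub 1).algebraMap_mem _) (mul_mem (mul_mem (gx_mem (Nat.zero_le _))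
        (gx_mem le_rfl)) (gx_mem (Nat.zero_le _)))
    have hg : MvPolynomial.C (1 / 2) * ((gx .ct - gx .tn) * gx .w) ∈ jetSub 1 :=
      mul_mem ((jetSub 1).algebraMap_mem _) (mul_mem (sub_mem (gx_mem (Nat.zero_le _))
        (gx_mem (Nat.zero_le _))) (gx_mem (Nat.zero_le _)))
    intro p q
    fin_cases p <;> fin_cases q <;> simp only [q0Mat, Fin.zero_eta, Fin.mk_one, Fin.reduceFinMk,
      Matrix.cons_val, Matrix.of_apply] <;> with_reducible first
      | exact zero_mem _
      | exact hh
      | exact hg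
      | exact neg_mem hg
  · ext p q : 1
    fin_cases p <;> fin_cases q <;>
      simp [q0Mat, intMat, structMat, Matrix.mul_apply, Fin.sum_univ_four, conjHom_gx, conjGen]
  · ext p q : 1
    fin_cases p <;> fin_cases q <;>
      simp [q0Mat, intMat, reflMat, Matrix.mul_apply, Fin.sum_univ_four, reflHom_gx, reflGen] <;>
      ring
  · intro J a ha x ξ h
    ext p q
    fin_cases p <;> fin_cases q <;>
      simp [q0, q0Mat, evalAt_gx, pointVal, genVal] <;>
      ring

theorem Adm.neg_I_smul {n : ℕ} {d e : ℤ} {F : (ℝ → ℝ) → Symb} (hF : Adm n d e F) :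
    Adm n (-d) e (fun a x ξ => (-Complex.I) • F a x ξ) := by
  simpa using hF.smul_I_pow 1 1

theorem Adm.neg {n : ℕ} {d e : ℤ} {F : (ℝ → ℝ) → Symb} (hF : Adm n d e F) :
    Adm n d e (fun a x ξ => -F a x ξ) := by
  simpa using hF.smul_I_pow 2 1

theorem Adm.dX_eq_zero {n : ℕ} {d e : ℤ} {F : (ℝ → ℝ) → Symb} (hF : Adm n d e F) {j : Fin 4}
    (hj : j = 2 ∨ j = 3) : Rep (fun a => dX j (F a)) 0 := by
  obtain ⟨X, -, -, -, h⟩ := hF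
  exact h.iterate_dX_angle hj one_ne_zero

theorem rep_zero_mul {F G : (ℝ → ℝ) → Symb} (hG : Rep G 0) (c : ℂ) :
    Rep (fun a x ξ => c • (F a x ξ * G a x ξ)) 0 := fun J a ha x ξ h => by
  have h0 := hG J a ha x ξ h
  rw [Matrix.map_zero _ (map_zero _)] at h0 ⊢
  simp only [h0, Matrix.mul_zero, smul_zero]

/-- The sum over `j` in the composition formula for first order operators. -/
theorem adm_sum_dXi_dX {m : ℕ} {d : ℤ} {F G : (ℝ → ℝ) → Symb} (hF : Adm 0 1 1 F)
    (hG : Adm m d 1 G) :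
    Adm (m + 1) (-d) 1 (fun a x ξ =>
      ∑ j : Fin 4, (-Complex.I) • (dXi j (F a) x ξ * dX j (G a) x ξ)) := by
  refine Adm.sum _ fun j _ => ?_
  rcases (by decide +revert : j = 0 ∨ j = 1 ∨ j = 2 ∨ j = 3) with rfl | rfl | hj
  · simpa using (hF.dXi_zero.mul hG.dX_zero).neg_I_smul
  -- The reflection signs of `∂/∂ξ₂` and `∂/∂η` cancel.
  · simpa using (hF.dXi_one.mul hG.dX_one).neg_I_smul
  · exact Adm.of_rep_zero (rep_zero_mul (F := fun a => dXi j (F a)) (hG.dX_eq_zero hj) _) _ _ _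

theorem p1_adm : Adm 1 (-1) 1 p1 := by
  have h1 : Adm 1 (-1) 1 fun a x ξ => q0 a x ξ * q1 a x ξ := by
    simpa only [mul_one, Nat.add_zero] using q0_adm.mul q1_adm
  have h2 : Adm 1 (-1) 1 fun a x ξ => q1 a x ξ * q0 a x ξ := by
    simpa only [mul_one, one_mul, Nat.zero_add] using q1_adm.mul q0_adm
  exact ((h1.add h2).add (adm_sum_dXi_dX q1_adm q1_adm)).congr fun a => by funext x ξ; rw [p1]

theorem p0_adm : Adm 2 1 1 p0 := by
  have h1 : Adm 2 1 1 fun a x ξ => q0 a x ξ * q0 a x ξ := by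
    simpa only [mul_one, neg_mul, one_mul, neg_neg, Nat.reduceAdd] using q0_adm.mul q0_adm
  have h2 := adm_sum_dXi_dX q1_adm q0_adm
  rw [neg_neg] at h2
  exact (h1.add h2).congr fun a => by funext x ξ; rw [p0]

/-- A scalar matrix is unaffected by conjugation, so only the invariance of the scalar is needed. -/
theorem smul_one_adm {P : GPoly} (hP : P ∈ jetSub 0) (h1 : conjHom P = P) (h2 : reflHom P = P)
    {F : (ℝ → ℝ) → Symb} (hF : ∀ (J : Set ℝ) (a : ℝ → ℝ), IsScale J a → ∀ x ξ, InPatch J x ξ →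
      F a x ξ = evalAt a x ξ P • 1) : Adm 0 1 1 F := by
  have hS : intMat structMat * intMat (-structMat) = 1 := intMat_mul (by decide)
  have hR : intMat reflMat * intMat reflMat = 1 := intMat_mul reflMat_mul
  refine ⟨P • 1, fun p q => ?_, ?_, ?_, fun J a ha x ξ h => ?_⟩
  · rw [Matrix.smul_apply, Matrix.one_apply]
    split_ifs
    · simpa using hP
    · simp
  · rw [Twisted, Matrix.mul_smul, Matrix.smul_mul, Matrix.mul_one, hS]
    ext p q : 1
    by_cases hpq : p = q <;> simp [hpq, h1]
  · rw [Twisted, Matrix.mul_smul, Matrix.smul_mul, Matrix.mul_one, hR]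
    ext p q : 1
    by_cases hpq : p = q <;> simp [hpq, h2]
  · rw [hF J a ha x ξ h]
    ext p q : 1
    by_cases hpq : p = q <;> simp [hpq]

theorem p2_adm : Adm 0 1 1 fun a => symbDelta a 2 := by
  have h1 : Adm 0 1 1 fun a => p2 a := by
    have h := q1_adm.mul q1_adm
    rw [mul_one] at h
    exact h.congr fun a => by funext x ξ; rw [p2]
  have h2 : Adm 0 1 1 fun _ _ ξ =>
      (((ξ 4) ^ 2 + (ξ 5) ^ 2 : ℝ) : ℂ) • (1 : Matrix (Fin 4) (Fin 4) ℂ) := by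
    refine smul_one_adm (P := gx (.u 4) ^ 2 + gx (.u 5) ^ 2) ?_ ?_ ?_ ?_
    · have hu : ∀ j, gx (.u j) ∈ jetSub 0 := fun j => gx_mem le_rfl
      exact add_mem (pow_mem (hu 4) 2) (pow_mem (hu 5) 2)
    · simp [conjHom_gx, conjGen]
    · simp [reflHom_gx, reflGen, reflSign]
    · intro J a ha x ξ h
      simp [evalAt_gx, pointVal, genVal, rescale]
  exact (h1.add h2).congr fun a => by funext x ξ; simp only [symbDelta, Matrix.cons_val]

/-- The weight complements the degree in `ξ`, and the conjugation sign is the parity of that degree.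
The subtraction is not truncated, as `k ≤ 2`. -/
theorem symbDelta_adm (k : Fin 3) :
    Adm (2 - (k : ℕ)) ((-1) ^ (k : ℕ)) 1 fun a => symbDelta a k := by
  fin_cases k
  · exact p0_adm
  · exact p1_adm
  · exact p2_adm

/-- The Clifford relations. They make the leading symbol scalar, so inverting it requires only the
generator `z`. -/
theorem q1_sq (a : ℝ → ℝ) (x : Fin 4 → ℝ) (ξ : Fin 6 → ℝ) :
    q1 a x ξ * q1 a x ξ = ((ξ 0 ^ 2 + (ξ 1 / a (x 0)) ^ 2 + (ξ 2 / (Real.sin (x 1) * a (x 0))) ^ 2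
      + (ξ 3 / (Real.cos (x 1) * a (x 0))) ^ 2 : ℝ) : ℂ) • 1 := by
  rw [q1]
  generalize ξ 1 / a (x 0) = e2
  generalize ξ 2 / (Real.sin (x 1) * a (x 0)) = e3
  generalize ξ 3 / (Real.cos (x 1) * a (x 0)) = e4
  generalize ξ 0 = e1
  have hI : Complex.I ^ 2 = -1 := Complex.I_sq
  ext p q
  fin_cases p <;> fin_cases q <;>
    simp [Matrix.mul_apply, Fin.sum_univ_four] <;> ring_nf <;> (try simp only [hI]) <;> (try ring)

theorem symbDelta_two (a : ℝ → ℝ) (x : Fin 4 → ℝ) (ξ : Fin 6 → ℝ) :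
    symbDelta a 2 x ξ = ((quadVal (a (x 0)) (rescale (x 1) ξ) : ℝ) : ℂ) • 1 := by
  change q1 a x ξ * q1 a x ξ + _ = _
  rw [q1_sq, ← add_smul]
  congr 1
  simp only [quadVal, rescale, Matrix.cons_val]
  push_cast
  ring

theorem paramSymb_zero_adm : Adm 0 1 1 fun a => paramSymb a 0 := by
  refine smul_one_adm (P := gx .z) (gx_mem le_rfl) ?_ ?_ ?_
  · simp [conjHom_gx, conjGen]
  · simp [reflHom_gx, reflGen]
  · intro J a ha x ξ h
    have hq : ((quadVal (a (x 0)) (rescale (x 1) ξ) : ℝ) : ℂ) ≠ 0 :=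
      Complex.ofReal_ne_zero.2 (h.quadVal_ne_zero ha)
    rw [paramSymb]
    change (symbDelta a 2 x ξ)⁻¹ = _
    rw [symbDelta_two, evalAt_gx]
    refine Matrix.inv_eq_right_inv ?_
    rw [Matrix.smul_mul, Matrix.one_mul, smul_smul]
    simp [pointVal, genVal, hq]

/-- The heart of the recursion: the constraint `2 + j + |ν| = n + k` on the summation indices is
exactly what makes weights and signs add up. -/
theorem paramSymb_adm (n : ℕ) : Adm n ((-1) ^ n) 1 fun a => paramSymb a n := by
  induction n using Nat.strong_induction_on with
  | _ n ih =>
    cases n with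
    | zero => simpa using paramSymb_zero_adm
    | succ n =>
      have key := (Adm.sum (n := n + 1) (d := (-1) ^ (n + 1)) (e := 1)
        (F := fun (j : Fin (n + 1)) a x ξ => ∑ k : Fin 3,
          ∑ ν ∈ (Fintype.piFinset fun _ : Fin 4 => Finset.range (n + 2)) with
              2 + (j : ℕ) + ∑ i, ν i = (n + 1) + (k : ℕ),
            ((-Complex.I) ^ (∑ i, ν i) / ((∏ i, (ν i).factorial : ℕ) : ℂ)) •
              (dXiMulti ν (paramSymb a j) x ξ * dXMulti ν (symbDelta a k) x ξ))
        Finset.univ fun j _ => Adm.sum _ fun k _ => Adm.sum _ fun ν hν => ?_).neg.mul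
          paramSymb_zero_adm
      · simp only [mul_one, Nat.add_zero] at key
        exact key.congr fun a => by funext x ξ; rw [paramSymb.eq_2]
      · have hν' := (Finset.mem_filter.1 hν).2
        by_cases h0 : ν 2 ≠ 0 ∨ ν 3 ≠ 0
        · exact Adm.of_rep_zero (rep_zero_mul (F := fun a => dXiMulti ν (paramSymb a j))
            ((symbDelta_adm k).dXMulti_eq_zero h0) _) _ _ _
        · obtain ⟨h2, h3⟩ : ν 2 = 0 ∧ ν 3 = 0 := by tauto
          have hs : ∑ i, ν i = ν 0 + ν 1 := by simp [Fin.sum_univ_four, h2, h3]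
          have t := (((ih j j.2).dXiMulti h2 h3).mul ((symbDelta_adm k).dXMulti h2 h3)).smul_I_pow
            (∑ i, ν i) (∏ i, (ν i).factorial)
          have hk := k.2
          -- Weight: `j` from the earlier symbol, `2 - k` from `p_k`, and one for each
          -- `x`-derivative.
          have e1 : (j : ℕ) + (2 - (k : ℕ) + ν 0 + ν 1) = n + 1 := by omega
          -- Conjugation sign: `|ν| + j + k` and `n + 1` differ by the even number `2k - 2`.
          have e2 : (-1 : ℤ) ^ (∑ i, ν i) * ((-1) ^ (j : ℕ) * (-1) ^ (k : ℕ)) = (-1) ^ (n + 1) := by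
            rw [← pow_add, ← pow_add]
            have : ∑ i, ν i + ((j : ℕ) + (k : ℕ)) + 2 = n + 1 + 2 * k := by omega
            calc (-1 : ℤ) ^ (∑ i, ν i + ((j : ℕ) + (k : ℕ)))
                = (-1) ^ (∑ i, ν i + ((j : ℕ) + (k : ℕ)) + 2) := by rw [pow_add _ _ 2]; simp
              _ = _ := by rw [this, pow_add, pow_mul]; simp
          -- Reflection sign: `η` and `ξ₂` are differentiated equally often.
          have e3 : (-1 : ℤ) ^ ν 1 * 1 * ((-1) ^ ν 1 * 1) = 1 := by
            rw [mul_one, ← pow_add, ← two_mul, pow_mul]; simp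
          rw [e1, e2, e3] at t
          exact t

/-- The trace is blind to the conjugating matrices, so twisted invariance of the matrix becomes
invariance of its trace. -/
theorem Twisted.trace_eq {φ : GPoly →ₐ[ℚ] GPoly} {S S' : Matrix (Fin 4) (Fin 4) ℤ} (h : S' * S = 1)
    {X : FMat} (hX : Twisted φ S S' 1 X) : φ X.trace = X.trace := by
  have h1 : φ X.trace = (X.map φ).trace := by simp [Matrix.trace]
  rw [h1, hX, Int.cast_one, one_smul, Matrix.trace_mul_comm, ← Matrix.mul_assoc, intMat_mul h,
    Matrix.one_mul]

theorem exists_trSymb_eq : ∃ T ∈ jetSub 4, conjHom T = T ∧ reflHom T = T ∧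
    ∀ (J : Set ℝ) (a : ℝ → ℝ), IsScale J a → ∀ x ξ, InPatch J x ξ →
      trSymb a x ξ = evalAt a x ξ T := by
  obtain ⟨X, h1, h2, h3, h4⟩ := paramSymb_adm 4
  refine ⟨X.trace, sum_mem fun i _ => h1 i i, Twisted.trace_eq structMat_mul (by simpa using h2),
    h3.trace_eq reflMat_mul, fun J a ha x ξ h => ?_⟩
  rw [trSymb]
  change ((fun a => paramSymb a 4) a x ξ).trace = _
  rw [h4 J a ha x ξ h]
  simp [Matrix.trace]

/-! ### Representable functions -/

/-- Functions which are, for `α ≠ 0`, the value of a list of summands. -/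
def Representable (g : ℝ → (Fin 4 → ℝ) → (Fin 7 → ℝ) → ℝ) : Prop :=
  ∃ f : List RatTerm, ∀ α β u, α ≠ 0 → g α β u = ratFun f α β u

/-- The product of two summands. -/
noncomputable def RatTerm.mul (S T : RatTerm) : RatTerm :=
  ⟨S.c * T.c, S.P * T.P, S.r + T.r, S.k + T.k, S.m + T.m, S.ℓ + T.ℓ⟩

theorem RatTerm.value_mul (S T : RatTerm) (α : ℝ) (β : Fin 4 → ℝ) (u : Fin 7 → ℝ) :
    (S.mul T).value α β u = S.value α β u * T.value α β u := by
  simp only [RatTerm.value, RatTerm.mul, MvPolynomial.eval₂_mul, Rat.cast_mul, map_mul, mul_add,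
    pow_add, div_eq_mul_inv, mul_inv]
  ring

theorem ratFun_append (f g : List RatTerm) (α : ℝ) (β : Fin 4 → ℝ) (u : Fin 7 → ℝ) :
    ratFun (f ++ g) α β u = ratFun f α β u + ratFun g α β u := by
  simp [ratFun]

theorem ratFun_map_mul (S : RatTerm) (g : List RatTerm) (α : ℝ) (β : Fin 4 → ℝ) (u : Fin 7 → ℝ) :
    ratFun (g.map S.mul) α β u = S.value α β u * ratFun g α β u := by
  simp [ratFun, Function.comp_def, RatTerm.value_mul, List.sum_map_mul_left]

theorem ratFun_flatMap (f g : List RatTerm) (α : ℝ) (β : Fin 4 → ℝ) (u : Fin 7 → ℝ) :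
    ratFun (f.flatMap fun S => g.map S.mul) α β u = ratFun f α β u * ratFun g α β u := by
  induction f with
  | nil => simp [ratFun]
  | cons S f ih =>
    rw [List.flatMap_cons, ratFun_append, ratFun_map_mul, ih, ← add_mul]
    simp [ratFun]

theorem Representable.add {g h : ℝ → (Fin 4 → ℝ) → (Fin 7 → ℝ) → ℝ} (hg : Representable g)
    (hh : Representable h) : Representable fun α β u => g α β u + h α β u := by
  obtain ⟨f, hf⟩ := hg
  obtain ⟨f', hf'⟩ := hh
  exact ⟨f ++ f', fun α β u hu => by simp only [ratFun_append, hf α β u hu, hf' α β u hu]⟩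

theorem Representable.mul {g h : ℝ → (Fin 4 → ℝ) → (Fin 7 → ℝ) → ℝ} (hg : Representable g)
    (hh : Representable h) : Representable fun α β u => g α β u * h α β u := by
  obtain ⟨f, hf⟩ := hg
  obtain ⟨f', hf'⟩ := hh
  exact ⟨f.flatMap fun S => f'.map S.mul, fun α β u hu => by
    simp only [ratFun_flatMap, hf α β u hu, hf' α β u hu]⟩

theorem Representable.of_term {g : ℝ → (Fin 4 → ℝ) → (Fin 7 → ℝ) → ℝ} (T : RatTerm)
    (h : ∀ α β u, α ≠ 0 → g α β u = T.value α β u) : Representable g :=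
  ⟨[T], fun α β u hu => by simp [ratFun, h α β u hu]⟩

theorem representable_const (q : ℚ) : Representable fun _ _ _ => (q : ℝ) :=
  .of_term ⟨q, 1, 0, 0, 0, 0⟩ fun α β u _ => by simp [RatTerm.value]

theorem representable_zero : Representable fun _ _ _ => 0 := by
  simpa using representable_const 0

theorem representable_one : Representable fun _ _ _ => 1 := by
  simpa using representable_const 1

theorem Representable.sub {g h : ℝ → (Fin 4 → ℝ) → (Fin 7 → ℝ) → ℝ} (hg : Representable g)
    (hh : Representable h) : Representable fun α β u => g α β u - h α β u := by
  have := hg.add ((representable_const (-1)).mul hh)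
  simpa [sub_eq_add_neg] using this

theorem representable_scale : Representable fun α _ _ => α :=
  .of_term ⟨1, MvPolynomial.X Var.scale, 0, 0, 0, 0⟩ fun α β u _ => by simp [RatTerm.value]

/-- Only even powers of `α` are allowed as denominators, hence `α / α²`. -/
theorem representable_scale_inv : Representable fun α _ _ => α⁻¹ :=
  .of_term ⟨1, MvPolynomial.X Var.scale, 1, 0, 0, 0⟩ fun α β u hu => by
    simp [RatTerm.value]
    field_simp

theorem representable_param (j : Fin 4) : Representable fun _ β _ => β j :=
  .of_term ⟨1, MvPolynomial.X (Var.param j), 0, 0, 0, 0⟩ fun α β u _ => by simp [RatTerm.value]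

theorem representable_coord (j : Fin 7) : Representable fun _ _ u => u j :=
  .of_term ⟨1, MvPolynomial.X (Var.u j), 0, 0, 0, 0⟩ fun α β u _ => by simp [RatTerm.value]

theorem representable_quadric_inv : Representable fun α _ u => (quadric α u)⁻¹ :=
  .of_term ⟨1, 1, 0, 0, 0, 1⟩ fun α β u _ => by simp [RatTerm.value]

theorem representable_cot_sq : Representable fun _ _ u => (1 - u 0) / u 0 :=
  .of_term ⟨1, 1 - MvPolynomial.X (Var.u 0), 0, 1, 0, 0⟩ fun α β u _ => by
    simp [RatTerm.value, MvPolynomial.eval₂_sub]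

theorem representable_tan_sq : Representable fun _ _ u => u 0 / (1 - u 0) :=
  .of_term ⟨1, MvPolynomial.X (Var.u 0), 0, 0, 1, 0⟩ fun α β u _ => by simp [RatTerm.value]

theorem quadVal_tail (α : ℝ) (u : Fin 7 → ℝ) : quadVal α (Fin.tail u) = quadric α u := by
  simp [quadVal, quadric, Fin.tail]

/-- The function `A + B c + I (C + D c)` with representable `A`, `B`, `C`, `D` has the values of
the formal symbol `T`, if `c² = (1 - u₀)/u₀`. -/
def Splits (T : GPoly) (A B C D : ℝ → (Fin 4 → ℝ) → (Fin 7 → ℝ) → ℝ) : Prop :=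
  ∀ (γ : ℕ → ℝ) (u : Fin 7 → ℝ) (c : ℝ), γ 0 ≠ 0 → c ^ 2 = (1 - u 0) / u 0 →
    MvPolynomial.aeval (genVal γ c (c * (u 0 / (1 - u 0))) (Fin.tail u)) T =
      ((A (γ 0) (fun j => γ (j + 1)) u + B (γ 0) (fun j => γ (j + 1)) u * c : ℝ) : ℂ) +
      Complex.I * ((C (γ 0) (fun j => γ (j + 1)) u + D (γ 0) (fun j => γ (j + 1)) u * c : ℝ) : ℂ)

/-- The combinations of `1`, `c`, `i`, `ic` with representable coefficients contain the generators'
values and are closed under products, since `c²` is representable and `i² = -1`. -/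
theorem exists_splits {T : GPoly} (hT : T ∈ jetSub 4) : ∃ A B C D, Representable A ∧
    Representable B ∧ Representable C ∧ Representable D ∧ Splits T A B C D := by
  induction hT using Algebra.adjoin_induction with
  | mem x hx =>
    obtain ⟨g, hg, rfl⟩ := hx
    have z := representable_zero
    cases g with
    | I => exact ⟨_, _, _, _, z, z, representable_one, z, fun γ u c _ _ => by simp [genVal]⟩
    | w =>
      exact ⟨_, _, _, _, representable_scale_inv, z, z, z, fun γ u c _ _ => by simp [genVal]⟩
    | jet j =>
      cases j with
      | zero => exact ⟨_, _, _, _, representable_scale, z, z, z, fun γ u c _ _ => by simp [genVal]⟩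
      | succ j =>
        -- The weight bound enters here: only the parameters `α₁, …, α₄` can occur.
        have hj : j < 4 := Nat.lt_of_succ_le hg
        exact ⟨_, _, _, _, representable_param ⟨j, hj⟩, z, z, z,
          fun γ u c _ _ => by simp [genVal]⟩
    | ct => exact ⟨_, _, _, _, z, representable_one, z, z, fun γ u c _ _ => by simp [genVal]⟩
    | tn =>
      exact ⟨_, _, _, _, z, representable_tan_sq, z, z, fun γ u c _ _ => by
        simp [genVal, mul_comm]⟩
    | u j =>
      exact ⟨_, _, _, _, representable_coord j.succ, z, z, z, fun γ u c _ _ => by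
        simp [genVal, Fin.tail]⟩
    | z =>
      exact ⟨_, _, _, _, representable_quadric_inv, z, z, z, fun γ u c _ _ => by
        simp [genVal, quadVal_tail]⟩
  | algebraMap r =>
    have z := representable_zero
    exact ⟨_, _, _, _, representable_const r, z, z, z, fun γ u c _ _ => by simp⟩
  | add x y _ _ hx hy =>
    obtain ⟨A, B, C, D, hA, hB, hC, hD, h⟩ := hx
    obtain ⟨A', B', C', D', hA', hB', hC', hD', h'⟩ := hy
    refine ⟨_, _, _, _, hA.add hA', hB.add hB', hC.add hC', hD.add hD', fun γ u c hu hc => ?_⟩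
    rw [map_add, h γ u c hu hc, h' γ u c hu hc]
    push_cast
    ring
  | mul x y _ _ hx hy =>
    obtain ⟨A, B, C, D, hA, hB, hC, hD, h⟩ := hx
    obtain ⟨A', B', C', D', hA', hB', hC', hD', h'⟩ := hy
    have hq := representable_cot_sq
    refine ⟨_, _, _, _,
      ((hA.mul hA').sub (hC.mul hC')).add (((hB.mul hB').sub (hD.mul hD')).mul hq),
      ((hA.mul hB').add (hB.mul hA')).sub ((hC.mul hD').add (hD.mul hC')),
      ((hA.mul hC').add (hC.mul hA')).add (((hB.mul hD').add (hD.mul hB')).mul hq),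
      ((hA.mul hD').add (hD.mul hA')).add ((hB.mul hC').add (hC.mul hB')),
      fun γ u c hu hc => ?_⟩
    rw [map_mul, h γ u c hu hc, h' γ u c hu hc]
    simp only [← hc]
    have hI : Complex.I ^ 2 = -1 := Complex.I_sq
    push_cast
    -- Once `c²` is restored, the two sides differ only by the product of the imaginary parts times
    -- `i² + 1`.
    linear_combination ((C (γ 0) (fun j => γ (j + 1)) u : ℂ) + D (γ 0) (fun j => γ (j + 1)) u * c) *
      ((C' (γ 0) (fun j => γ (j + 1)) u : ℂ) + D' (γ 0) (fun j => γ (j + 1)) u * c) * hI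

/-! ### The even part of the trace -/

/-- All generators except `I` take real values. -/
theorem aeval_conjHom (γ : ℕ → ℝ) (c s : ℝ) (v : Fin 6 → ℝ) (T : GPoly) :
    MvPolynomial.aeval (genVal γ c s v) (conjHom T) =
      starRingEnd ℂ (MvPolynomial.aeval (genVal γ c s v) T) := by
  induction T using MvPolynomial.induction_on with
  | C r =>
    have : conjHom (MvPolynomial.C r) = MvPolynomial.C r := conjHom.commutes r
    simp [this]
  | add P Q hP hQ => simp [hP, hQ]
  | mul_X P g hP =>
    rw [map_mul, map_mul, hP, map_mul, map_mul, conjHom_gx, MvPolynomial.aeval_X]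
    congr 1
    cases g <;> simp [conjGen, genVal]

theorem quadVal_sign (α : ℝ) (ε : Fin 6 → ℤ) (hε : ∀ j, ε j ^ 2 = 1) (v : Fin 6 → ℝ) :
    quadVal α (fun j => (ε j : ℝ) * v j) = quadVal α v := by
  have h : ∀ j, (ε j : ℝ) ^ 2 = 1 := fun j => by exact_mod_cast hε j
  simp only [quadVal, mul_pow, h, one_mul]

theorem aeval_reflHom (γ : ℕ → ℝ) (c s : ℝ) (v : Fin 6 → ℝ) (T : GPoly) :
    MvPolynomial.aeval (genVal γ c s v) (reflHom T) =
      MvPolynomial.aeval (genVal γ (-c) (-s) fun j => (reflSign j : ℝ) * v j) T := by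
  induction T using MvPolynomial.induction_on with
  | C r =>
    have : reflHom (MvPolynomial.C r) = MvPolynomial.C r := reflHom.commutes r
    simp [this]
  | add P Q hP hQ => simp [hP, hQ]
  | mul_X P g hP =>
    rw [map_mul, map_mul, hP, map_mul, reflHom_gx, MvPolynomial.aeval_X]
    congr 1
    cases g <;> simp [reflGen, genVal, quadVal_sign _ reflSign (by decide)]

/-- The change of the signs of the rescaled covectors, on generators. -/
noncomputable def signGen (ε : Fin 6 → ℤˣ) : Gen → GPoly
  | .I => gx .I
  | .w => gx .w
  | .jet j => gx (.jet j)
  | .ct => gx .ct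
  | .tn => gx .tn
  | .u j => ((ε j : ℤ) : GPoly) * gx (.u j)
  | .z => gx .z

/-- The change of the signs of the rescaled covectors. -/
noncomputable def signHom (ε : Fin 6 → ℤˣ) : GPoly →ₐ[ℚ] GPoly := MvPolynomial.aeval (signGen ε)

theorem signHom_gx (ε : Fin 6 → ℤˣ) (g : Gen) : signHom ε (gx g) = signGen ε g :=
  MvPolynomial.aeval_X _ _

theorem signHom_mem {n : ℕ} (ε : Fin 6 → ℤˣ) {T : GPoly} (hT : T ∈ jetSub n) :
    signHom ε T ∈ jetSub n := by
  induction hT using Algebra.adjoin_induction with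
  | mem x hx =>
    obtain ⟨g, hg, rfl⟩ := hx
    rw [signHom_gx]
    cases g with
    | u j => exact mul_mem (intCast_mem _ _) (gx_mem hg)
    | _ => exact gx_mem hg
  | algebraMap r => rw [AlgHom.commutes]; exact (jetSub n).algebraMap_mem r
  | add x y _ _ hx hy => rw [map_add]; exact add_mem hx hy
  | mul x y _ _ hx hy => rw [map_mul]; exact mul_mem hx hy

theorem aeval_signHom (ε : Fin 6 → ℤˣ) (γ : ℕ → ℝ) (c s : ℝ) (v : Fin 6 → ℝ) (T : GPoly) :
    MvPolynomial.aeval (genVal γ c s v) (signHom ε T) =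
      MvPolynomial.aeval (genVal γ c s fun j => ((ε j : ℤ) : ℝ) * v j) T := by
  induction T using MvPolynomial.induction_on with
  | C r =>
    have : signHom ε (MvPolynomial.C r) = MvPolynomial.C r := (signHom ε).commutes r
    simp [this]
  | add P Q hP hQ => simp [hP, hQ]
  | mul_X P g hP =>
    rw [map_mul, map_mul, hP, map_mul, signHom_gx, MvPolynomial.aeval_X]
    congr 1
    cases g with
    | z =>
      have h : ∀ j, ((ε j : ℤ)) ^ 2 = 1 := fun j => by
        rw [← Units.val_pow_eq_pow_val, Int.units_sq, Units.val_one]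
      simp [signGen, genVal, quadVal_sign _ (fun j => (ε j : ℤ)) h]
    | _ => simp [signGen, genVal]

/-- The average of a formal symbol over all changes of signs. -/
noncomputable def evenPart (T : GPoly) : GPoly :=
  MvPolynomial.C (1 / 64) * ∑ ε : Fin 6 → ℤˣ, signHom ε T

theorem evenPart_mem {n : ℕ} {T : GPoly} (hT : T ∈ jetSub n) : evenPart T ∈ jetSub n :=
  mul_mem ((jetSub n).algebraMap_mem _) (sum_mem fun ε _ => signHom_mem ε hT)

theorem aeval_evenPart (γ : ℕ → ℝ) (c s : ℝ) (v : Fin 6 → ℝ) (T : GPoly) :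
    MvPolynomial.aeval (genVal γ c s v) (evenPart T) = (1 / 64 : ℂ) * ∑ ε : Fin 6 → ℤˣ,
      MvPolynomial.aeval (genVal γ c s fun j => ((ε j : ℤ) : ℝ) * v j) T := by
  simp only [evenPart, map_mul, map_sum, aeval_signHom, MvPolynomial.aeval_C]
  simp

theorem aeval_evenPart_conj {T : GPoly} (hT : conjHom T = T) (γ : ℕ → ℝ) (c s : ℝ)
    (v : Fin 6 → ℝ) : starRingEnd ℂ (MvPolynomial.aeval (genVal γ c s v) (evenPart T)) =
      MvPolynomial.aeval (genVal γ c s v) (evenPart T) := by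
  rw [aeval_evenPart, map_mul, map_sum]
  simp only [← aeval_conjHom, hT]
  rw [map_div₀, map_one, map_ofNat]

/-- The reflection negates `cot` and `tan` but also `u₂` and `u₃`. In the average over all sign
changes the latter is a translation of the index group by `ε₀`, so only the change of `c` and `s`
remains. -/
theorem aeval_evenPart_neg {T : GPoly} (hT : reflHom T = T) (γ : ℕ → ℝ) (c s : ℝ)
    (v : Fin 6 → ℝ) : MvPolynomial.aeval (genVal γ (-c) (-s) v) (evenPart T) =
      MvPolynomial.aeval (genVal γ c s v) (evenPart T) := by
  rw [aeval_evenPart, aeval_evenPart]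
  congr 1
  let ε₀ : Fin 6 → ℤˣ := ![1, -1, -1, 1, 1, 1]
  have h0 : ∀ j, reflSign j = (ε₀ j : ℤ) := by decide
  rw [← Equiv.sum_comp (Equiv.mulLeft ε₀)]
  refine Finset.sum_congr rfl fun ε _ => ?_
  conv_rhs => rw [← hT, aeval_reflHom]
  congr 3
  funext j
  rw [h0, ← mul_assoc, ← Int.cast_mul, ← Units.val_mul]
  rfl

theorem exists_ratFun_evenPart {T : GPoly} (hT : T ∈ jetSub 4) (h1 : conjHom T = T)
    (h2 : reflHom T = T) : ∃ f : List RatTerm, ∀ (γ : ℕ → ℝ) (u : Fin 7 → ℝ) (c : ℝ),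
      γ 0 ≠ 0 → c ^ 2 = (1 - u 0) / u 0 →
      MvPolynomial.aeval (genVal γ c (c * (u 0 / (1 - u 0))) (Fin.tail u)) (evenPart T) =
        ((ratFun f (γ 0) (fun j => γ (j + 1)) u : ℝ) : ℂ) := by
  obtain ⟨A, B, C, D, ⟨f, hf⟩, -, -, -, h⟩ := exists_splits (evenPart_mem hT)
  refine ⟨f, fun γ u c hu hc => ?_⟩
  have e1 := h γ u c hu hc
  -- The hypothesis on `c` concerns only `c²`, so both square roots may be used. The two expansions
  -- have the same left side, and averaging their real parts removes `B`.
  have e2 := h γ u (-c) hu (by rw [neg_sq, hc])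
  rw [neg_mul, aeval_evenPart_neg h2] at e2
  have e3 := aeval_evenPart_conj h1 γ c (c * (u 0 / (1 - u 0))) (Fin.tail u)
  rw [← hf _ _ _ hu]
  apply Complex.ext
  · have r1 := congrArg Complex.re e1
    have r2 := congrArg Complex.re e2
    simp only [Complex.add_re, Complex.mul_re, Complex.I_re, Complex.I_im, Complex.ofReal_re,
      Complex.ofReal_im] at r1 r2 ⊢
    linarith
  · rw [Complex.conj_eq_iff_im] at e3
    rw [e3, Complex.ofReal_im]

theorem uCoord_cons (η : ℝ) (ξ : Fin 6 → ℝ) :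
    uCoord (Fin.cons η ξ) = Fin.cons (Real.sin η ^ 2) (rescale η ξ) := by
  funext j
  refine Fin.cases ?_ (fun i => ?_) j
  · simp [uCoord]
  · fin_cases i <;> rfl

theorem rescale_sign (η : ℝ) (ε : Fin 6 → ℝ) (ξ : Fin 6 → ℝ) :
    rescale η (fun j => ε j * ξ j) = fun j => ε j * rescale η ξ j := by
  funext j
  fin_cases j <;> simp [rescale, mul_div_assoc]

theorem InPatch.sign {J : Set ℝ} {x : Fin 4 → ℝ} {ξ : Fin 6 → ℝ} (h : InPatch J x ξ)
    (ε : Fin 6 → ℤˣ) : InPatch J x fun j => ((ε j : ℤ) : ℝ) * ξ j := by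
  refine ⟨h.time, h.angle, fun h0 => h.cov ?_⟩
  funext j
  have := congrFun h0 j
  simpa using this

theorem exists_ratFun_b6 : ∃ f : List RatTerm, ∀ (J : Set ℝ) (a : ℝ → ℝ), IsScale J a →
    ∀ x ξ, InPatch J x ξ → b6 a x ξ =
      ((ratFun f (a (x 0)) (fun j : Fin 4 => iteratedDeriv ((j : ℕ) + 1) a (x 0))
        (uCoord (Fin.cons (x 1) ξ)) : ℝ) : ℂ) := by
  obtain ⟨T, hT, h1, h2, h3⟩ := exists_trSymb_eq
  obtain ⟨f, hf⟩ := exists_ratFun_evenPart hT h1 h2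
  refine ⟨f, fun J a ha x ξ h => ?_⟩
  have hs := h.sin_pos.ne'
  have hc := h.cos_pos.ne'
  have e0 : uCoord (Fin.cons (x 1) ξ) 0 = Real.sin (x 1) ^ 2 := by rw [uCoord_cons, Fin.cons_zero]
  -- At `u₀ = sin² η` the cotangent is a square root of `(1 - u₀)/u₀`.
  have key := hf (fun j => iteratedDeriv j a (x 0)) (uCoord (Fin.cons (x 1) ξ)) (Real.cot (x 1))
    (by simpa using ha.ne_zero _ h.time) (by
      rw [e0, ← Real.cos_sq', Real.cot_eq_cos_div_sin, div_pow])
  have ht : Real.cot (x 1) * (Real.sin (x 1) ^ 2 / (1 - Real.sin (x 1) ^ 2)) = Real.tan (x 1) := by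
    rw [← Real.cos_sq', Real.cot_eq_cos_div_sin, Real.tan_eq_sin_div_cos]
    field_simp
  rw [iteratedDeriv_zero] at key
  rw [← key, e0, ht, uCoord_cons, Fin.tail_cons, aeval_evenPart, b6]
  congr 1
  refine Finset.sum_congr rfl fun ε _ => ?_
  rw [h3 J a ha x _ (h.sign ε), evalAt, pointVal, rescale_sign]

/-! ### The pull-back of `Ω` -/

theorem alternatingMap_sum_apply {R M N ι κ : Type*} [Semiring R] [AddCommMonoid M] [Module R M]
    [AddCommMonoid N] [Module R N] (s : Finset κ) (f : κ → M [⋀^ι]→ₗ[R] N) (v : ι → M) :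
    (∑ i ∈ s, f i) v = ∑ i ∈ s, f i v := by
  classical
  induction s using Finset.induction_on with
  | empty => rfl
  | insert i s hi ih =>
    rw [Finset.sum_insert hi, Finset.sum_insert hi, AlternatingMap.add_apply, ih]

theorem detRowAlternating_apply {n R : Type*} [DecidableEq n] [Fintype n] [CommRing R]
    (M : n → n → R) : Matrix.detRowAlternating M = (Matrix.of M).det := rfl

theorem dWedge_apply (s : Fin 6 → Fin 7) (v : Fin 6 → Fin 7 → ℝ) :
    dWedge s v = ((Matrix.det (Matrix.of fun i => LinearMap.funLeft ℝ ℝ s (v i)) : ℝ) : ℂ) := by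
  simp only [dWedge, LinearMap.compAlternatingMap_apply, AlternatingMap.compLinearMap_apply,
    detRowAlternating_apply]
  exact Complex.ofRealCLM_apply _

/-- Laplace expansion along the first row, which is the Euler field `(0, ξ)`. The minus sign comes
from the sign `(-1)^{j-1}`, where the expansion has `(-1)^j`. -/
theorem sphereForm_apply (y : Fin 7 → ℝ) (v : Fin 6 → Fin 7 → ℝ) :
    sphereForm y v = ((-(Matrix.of (Fin.cons (Fin.cons 0 (Fin.tail y)) v :
      Fin 7 → Fin 7 → ℝ)).det : ℝ) : ℂ) := by
  rw [Matrix.det_succ_row_zero, Fin.sum_univ_succ]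
  have hsum : sphereForm y v = ∑ j : Fin 6,
      ((((-1) ^ (j : ℕ) * y j.succ : ℝ)) : ℂ) • dWedge j.succ.succAbove v := by
    simp only [sphereForm, alternatingMap_sum_apply, AlternatingMap.smul_apply]
  rw [hsum]
  simp only [Matrix.of_apply, Fin.cons_zero, mul_zero, zero_mul, zero_add, Fin.cons_succ,
    ← Finset.sum_neg_distrib, Complex.ofReal_sum]
  refine Finset.sum_congr rfl fun j _ => ?_
  rw [Fin.val_succ, pow_succ, smul_eq_mul]
  rw [dWedge_apply, ← Complex.ofReal_mul]
  congr 1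
  have : (Matrix.of fun i => LinearMap.funLeft ℝ ℝ j.succ.succAbove (v i)) =
      (Matrix.of (Fin.cons (Fin.cons 0 (Fin.tail y)) v : Fin 7 → Fin 7 → ℝ)).submatrix
        Fin.succ j.succ.succAbove := by
    ext p q
    simp [LinearMap.funLeft_apply]
  rw [← this]
  simp only [mul_neg, mul_one, neg_mul, neg_neg, Fin.tail]

/-- The Jacobian matrix of the change of coordinates. -/
noncomputable def jacobian (y : Fin 7 → ℝ) : Matrix (Fin 7) (Fin 7) ℝ :=
  let s := Real.sin (y 0)
  let c := Real.cos (y 0)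
  !![2 * s * c, 0, 0, 0, 0, 0, 0;
     0, 1, 0, 0, 0, 0, 0;
     0, 0, 1, 0, 0, 0, 0;
     -(y 3 * c / s ^ 2), 0, 0, s⁻¹, 0, 0, 0;
     y 4 * s / c ^ 2, 0, 0, 0, c⁻¹, 0, 0;
     0, 0, 0, 0, 0, 1, 0;
     0, 0, 0, 0, 0, 0, 1]

/-- The factors `csc η` and `sec η` cancel `sin η cos η` in `du₀ = 2 sin η cos η dη`; the remaining
`2` explains the factor `1/2` in `sigmaTilde`. -/
theorem det_jacobian (y : Fin 7 → ℝ) (hs : Real.sin (y 0) ≠ 0) (hc : Real.cos (y 0) ≠ 0) :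
    (jacobian y).det = 2 := by
  rw [Matrix.det_of_isLowerTriangular]
  · simp [jacobian, Fin.prod_univ_succ]
    field_simp
  · intro i j hij
    fin_cases i <;> fin_cases j <;> first | rfl | exact absurd hij (by decide)

theorem hasFDerivAt_uCoord (y : Fin 7 → ℝ) (hs : Real.sin (y 0) ≠ 0) (hc : Real.cos (y 0) ≠ 0) :
    HasFDerivAt uCoord (Matrix.toLin' (jacobian y)).toContinuousLinearMap y := by
  rw [hasFDerivAt_pi']
  have p : ∀ i : Fin 7, HasFDerivAt (fun z : Fin 7 → ℝ => z i)
    (ContinuousLinearMap.proj (R := ℝ) (φ := fun _ => ℝ) i) y := fun i => hasFDerivAt_apply i y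
  have hsin := (Real.hasDerivAt_sin (y 0)).comp_hasFDerivAt y (p 0)
  intro i
  fin_cases i
  · refine (hsin.pow 2).congr_fderiv ?_
    ext v
    simp [jacobian, Matrix.toLin'_apply, dotProduct, Fin.sum_univ_succ]
    ring
  · refine (p 1).congr_fderiv ?_
    ext v
    simp [jacobian, Matrix.toLin'_apply, dotProduct, Fin.sum_univ_succ]
  · refine (p 2).congr_fderiv ?_
    ext v
    simp [jacobian, Matrix.toLin'_apply, dotProduct, Fin.sum_univ_succ]
  · refine ((p 3).mul (((Real.hasDerivAt_sin (y 0)).inv hs).comp_hasFDerivAt y (p 0))).congr_fderiv ?_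
    ext v
    simp [jacobian, Matrix.toLin'_apply, dotProduct, Fin.sum_univ_succ]
    ring
  · refine ((p 4).mul (((Real.hasDerivAt_cos (y 0)).inv hc).comp_hasFDerivAt y (p 0))).congr_fderiv ?_
    ext v
    simp [jacobian, Matrix.toLin'_apply, dotProduct, Fin.sum_univ_succ]
    ring
  · refine (p 5).congr_fderiv ?_
    ext v
    simp [jacobian, Matrix.toLin'_apply, dotProduct, Fin.sum_univ_succ]
  · refine (p 6).congr_fderiv ?_
    ext v
    simp [jacobian, Matrix.toLin'_apply, dotProduct, Fin.sum_univ_succ]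

/-- For fixed `η` the coordinates `u₁, …, u₆` are linear in `ξ`, so the Euler field goes to the
Euler field. -/
theorem jacobian_mulVec (y : Fin 7 → ℝ) :
    (jacobian y).mulVec (Fin.cons 0 (Fin.tail y)) = Fin.cons 0 (Fin.tail (uCoord y)) := by
  have e : (Fin.cons 0 (Fin.tail y) : Fin 7 → ℝ) = ![0, y 1, y 2, y 3, y 4, y 5, y 6] := by
    funext j
    fin_cases j <;> rfl
  have e' : (Fin.cons 0 (Fin.tail (uCoord y)) : Fin 7 → ℝ) =
      ![0, y 1, y 2, y 3 / Real.sin (y 0), y 4 / Real.cos (y 0), y 5, y 6] := by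
    funext j
    fin_cases j <;> rfl
  rw [e, e']
  funext j
  fin_cases j <;> simp [jacobian, div_eq_mul_inv, mul_comm]

theorem pullback_sphereForm (y : Fin 7 → ℝ) (hs : Real.sin (y 0) ≠ 0) (hc : Real.cos (y 0) ≠ 0) :
    pullback uCoord sphereForm y = (2 : ℂ) • sphereForm y := by
  ext v
  have hd : fderiv ℝ uCoord y = (Matrix.toLin' (jacobian y)).toContinuousLinearMap :=
    (hasFDerivAt_uCoord y hs hc).fderiv
  have hrow : (Matrix.of (Fin.cons (Fin.cons 0 (Fin.tail (uCoord y)))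
      (fun i => (jacobian y).mulVec (v i)) : Fin 7 → Fin 7 → ℝ)) =
      (Matrix.of (Fin.cons (Fin.cons 0 (Fin.tail y)) v : Fin 7 → Fin 7 → ℝ)) *
        (jacobian y).transpose := by
    ext i j
    refine Fin.cases ?_ (fun i => ?_) i
    · rw [Matrix.of_apply, Fin.cons_zero, ← jacobian_mulVec, Matrix.mul_apply,
        Matrix.mulVec, dotProduct]
      exact Finset.sum_congr rfl fun k _ => mul_comm (jacobian y j k) _
    · rw [Matrix.of_apply, Fin.cons_succ, Matrix.mul_apply, Matrix.mulVec, dotProduct]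
      exact Finset.sum_congr rfl fun k _ => mul_comm (jacobian y j k) _
  have h1 : pullback uCoord sphereForm y v =
      sphereForm (uCoord y) fun i => (jacobian y).mulVec (v i) := by
    simp only [pullback, AlternatingMap.compLinearMap_apply, hd,
      LinearMap.coe_toContinuousLinearMap, Matrix.toLin'_apply]
  rw [h1, sphereForm_apply, hrow, Matrix.det_mul, Matrix.det_transpose, det_jacobian y hs hc,
    AlternatingMap.smul_apply, sphereForm_apply]
  push_cast
  rw [smul_eq_mul]
  ring

theorem pullback_omegaForm (f : List RatTerm) (α : ℝ) (β : Fin 4 → ℝ) (y : Fin 7 → ℝ)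
    (hs : Real.sin (y 0) ≠ 0) (hc : Real.cos (y 0) ≠ 0) :
    pullback uCoord (omegaForm f α β) y = ((ratFun f α β (uCoord y) : ℝ) : ℂ) • sphereForm y := by
  have h := pullback_sphereForm y hs hc
  have h2 : pullback uCoord (omegaForm f α β) y =
      ((ratFun f α β (uCoord y) : ℝ) : ℂ) • (1 / 2 : ℂ) • pullback uCoord sphereForm y := rfl
  rw [h2, h, smul_smul (1 / 2 : ℂ)]
  norm_num

/-! ### Integration over the cosphere -/

open MeasureTheory

section Sphere

variable {E : Type*} [NormedAddCommGroup E] [InnerProductSpace ℝ E]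

/-- The action of a linear isometry on the unit sphere. -/
noncomputable def sphereEquiv (L : E ≃ₗᵢ[ℝ] E) :
    Metric.sphere (0 : E) 1 ≃ₜ Metric.sphere (0 : E) 1 :=
  L.toHomeomorph.subtype fun v => by simp

theorem coe_sphereEquiv (L : E ≃ₗᵢ[ℝ] E) (v : Metric.sphere (0 : E) 1) :
    (sphereEquiv L v : E) = L v := rfl

-- The surface measure of a set is a multiple of the volume of the cone over it, and a linear
-- isometry carries cones to cones of equal volume.
open scoped Pointwise in
theorem measurePreserving_sphereEquiv [FiniteDimensional ℝ E] [MeasurableSpace E] [BorelSpace E]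
    (L : E ≃ₗᵢ[ℝ] E) :
    MeasurePreserving (sphereEquiv L) (volume : Measure E).toSphere
      (volume : Measure E).toSphere := by
  refine ⟨(sphereEquiv L).measurable, Measure.ext fun s hs => ?_⟩
  have hm := (sphereEquiv L).measurable hs
  rw [Measure.map_apply (sphereEquiv L).measurable hs, Measure.toSphere_apply' _ hm,
    Measure.toSphere_apply' _ hs]
  congr 1
  have hL : MeasurePreserving L.toMeasurableEquiv (volume : Measure E) volume :=
    L.measurePreserving
  rw [← hL.measure_preimage_equiv (Set.Ioo (0 : ℝ) 1 • (Subtype.val '' s))]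
  congr 1
  ext v
  simp only [Set.mem_smul, Set.mem_image, Set.mem_preimage]
  constructor
  · rintro ⟨r, hr, w, ⟨p, hp, rfl⟩, rfl⟩
    exact ⟨r, hr, _, ⟨sphereEquiv L p, hp, rfl⟩, (map_smul L r (p : E)).symm⟩
  · rintro ⟨r, hr, w, ⟨p, hp, rfl⟩, (h : _ = L v)⟩
    refine ⟨r, hr, _, ⟨(sphereEquiv L).symm p, by simpa using hp, rfl⟩, ?_⟩
    apply L.injective
    rw [map_smul, ← coe_sphereEquiv, Homeomorph.apply_symm_apply]
    exact h

end Sphere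

/-- A diagonal matrix of signs as a linear isometry. -/
noncomputable def signIsometry (ε : Fin 6 → ℤˣ) :
    EuclideanSpace ℝ (Fin 6) ≃ₗᵢ[ℝ] EuclideanSpace ℝ (Fin 6) :=
  LinearIsometryEquiv.piLpCongrRight 2 fun j =>
    if ε j = 1 then LinearIsometryEquiv.refl ℝ ℝ else LinearIsometryEquiv.neg ℝ

theorem signIsometry_apply (ε : Fin 6 → ℤˣ) (v : EuclideanSpace ℝ (Fin 6)) (j : Fin 6) :
    signIsometry ε v j = ((ε j : ℤ) : ℝ) * v j := by
  rcases Int.units_eq_one_or (ε j) with h | h <;> simp [signIsometry, h]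

theorem sphereIntegral_sign (F : (Fin 6 → ℝ) → ℂ) (ε : Fin 6 → ℤˣ) :
    sphereIntegral (fun ξ => F fun j => ((ε j : ℤ) : ℝ) * ξ j) = sphereIntegral F := by
  have := (measurePreserving_sphereEquiv (signIsometry ε)).integral_comp
    (sphereEquiv (signIsometry ε)).measurableEmbedding
    fun v => F fun i => (v : EuclideanSpace ℝ (Fin 6)) i
  simp only [coe_sphereEquiv, signIsometry_apply] at this
  exact this

theorem sphere_ne_zero (v : Metric.sphere (0 : EuclideanSpace ℝ (Fin 6)) 1) :
    (fun i => (v : EuclideanSpace ℝ (Fin 6)) i) ≠ 0 := by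
  intro h
  have h0 : (v : EuclideanSpace ℝ (Fin 6)) = 0 := by
    ext i
    exact congrFun h i
  have hv := v.2
  rw [h0] at hv
  simp at hv

theorem continuous_evalAt_sphere {J : Set ℝ} {a : ℝ → ℝ} (ha : IsScale J a) {x : Fin 4 → ℝ}
    (ht : x 0 ∈ J) (hη : x 1 ∈ Set.Ioo 0 (Real.pi / 2)) (P : GPoly) :
    Continuous fun v : Metric.sphere (0 : EuclideanSpace ℝ (Fin 6)) 1 =>
      evalAt a x (fun i => (v : EuclideanSpace ℝ (Fin 6)) i) P := by
  have hv : ∀ i : Fin 6, Continuous fun v : Metric.sphere (0 : EuclideanSpace ℝ (Fin 6)) 1 =>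
      (v : EuclideanSpace ℝ (Fin 6)) i := fun i => by fun_prop
  have hr : ∀ i : Fin 6, Continuous fun v : Metric.sphere (0 : EuclideanSpace ℝ (Fin 6)) 1 =>
      rescale (x 1) (fun i => (v : EuclideanSpace ℝ (Fin 6)) i) i := fun i => by
    fin_cases i
    · exact hv 0
    · exact hv 1
    · exact (hv 2).div_const _
    · exact (hv 3).div_const _
    · exact hv 4
    · exact hv 5
  have hg : ∀ g : Gen, Continuous fun v : Metric.sphere (0 : EuclideanSpace ℝ (Fin 6)) 1 =>
      pointVal a x (fun i => (v : EuclideanSpace ℝ (Fin 6)) i) g := fun g => by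
    cases g with
    | u j => exact Complex.continuous_ofReal.comp (hr j)
    | z =>
      refine Complex.continuous_ofReal.comp (Continuous.inv₀ ?_ fun v => ?_)
      · simp only [quadVal]
        exact (((((hr 0).pow 2).add (continuous_const.mul
          ((((hr 1).pow 2).add ((hr 2).pow 2)).add ((hr 3).pow 2)))).add ((hr 4).pow 2)).add
          ((hr 5).pow 2))
      · simpa using InPatch.quadVal_ne_zero ha ⟨ht, hη, sphere_ne_zero v⟩
    | _ => exact continuous_const
  induction P using MvPolynomial.induction_on with
  | C r => simpa [evalAt] using continuous_const
  | add P Q hP hQ => simpa only [map_add] using hP.fun_add hQ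
  | mul_X P g hP => simpa only [map_mul, evalAt_gx] using hP.fun_mul (hg g)

/-- The integral of the average is the average of `64` equal integrals. Integrability, needed to
exchange sum and integral, comes from continuity on the compact sphere. -/
theorem sphereIntegral_b6 {J : Set ℝ} {a : ℝ → ℝ} (ha : IsScale J a) {x : Fin 4 → ℝ}
    (ht : x 0 ∈ J) (hη : x 1 ∈ Set.Ioo 0 (Real.pi / 2)) :
    sphereIntegral (trSymb a x) = sphereIntegral (b6 a x) := by
  obtain ⟨T, -, -, -, hT⟩ := exists_trSymb_eq
  have hc : Continuous fun v : Metric.sphere (0 : EuclideanSpace ℝ (Fin 6)) 1 =>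
      trSymb a x fun i => (v : EuclideanSpace ℝ (Fin 6)) i :=
    (continuous_evalAt_sphere ha ht hη T).congr fun v =>
      (hT J a ha x _ ⟨ht, hη, sphere_ne_zero v⟩).symm
  have hi : ∀ ε : Fin 6 → ℤˣ, Integrable (fun v : Metric.sphere (0 : EuclideanSpace ℝ (Fin 6)) 1 =>
      trSymb a x fun i => ((ε i : ℤ) : ℝ) * (v : EuclideanSpace ℝ (Fin 6)) i)
      (volume : Measure (EuclideanSpace ℝ (Fin 6))).toSphere := fun ε => by
    have h := hc.comp (sphereEquiv (signIsometry ε)).continuous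
    simp only [Function.comp_def, coe_sphereEquiv, signIsometry_apply] at h
    exact h.integrable_of_hasCompactSupport (HasCompactSupport.of_compactSpace _)
  have h1 : sphereIntegral (b6 a x) = (1 / 64 : ℂ) * ∑ ε : Fin 6 → ℤˣ,
      sphereIntegral fun ξ => trSymb a x fun i => ((ε i : ℤ) : ℝ) * ξ i := by
    simp only [sphereIntegral, b6]
    rw [integral_const_mul, integral_finsetSum _ fun ε _ => hi ε]
  rw [h1]
  simp only [sphereIntegral_sign]
  simp

/-! ### Regularity of the algebraic form -/

section Algebraic

theorem algebraMap_quadric {K B C : Type*} [Field K] [CommRing B] [CommRing C] [Algebra K B]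
    [Algebra K C] (α : K) (φ : B →ₐ[K] C) (u : Fin 7 → B) :
    φ (quadric α u) = quadric α fun i => φ (u i) := by
  simp [quadric]

theorem exists_algebraMap_eq_inv {A F : Type*} [CommRing A] [Field F] [Algebra A F] {x : A}
    (hx : IsUnit x) : ∃ y : A, algebraMap A F y = (algebraMap A F x)⁻¹ := by
  obtain ⟨v, rfl⟩ := hx
  refine ⟨↑v⁻¹, eq_inv_of_mul_eq_one_left ?_⟩
  rw [← map_mul, Units.inv_mul, map_one]

theorem RatTerm.exists_value_eq {K A F : Type*} [Field K] [CharZero K] [CommRing A] [Field F]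
    [Algebra K A] [Algebra K F] [Algebra A F] [IsScalarTower K A F] {α : K} (hα : α ≠ 0)
    (β : Fin 4 → K) {u : Fin 7 → A} (h1 : IsUnit (u 0)) (h2 : IsUnit (1 - u 0))
    (h3 : IsUnit (quadric α u)) (T : RatTerm) :
    ∃ y : A, algebraMap A F y = T.value α β fun i => algebraMap A F (u i) := by
  have h0 : IsUnit (algebraMap K A α) := (IsUnit.mk0 α hα).map _
  -- The whole denominator is a unit of `A`, so its inverse in `F` already comes from `A`.
  obtain ⟨d, hd⟩ := exists_algebraMap_eq_inv (F := F)
    ((((h0.pow (2 * T.r)).mul (h1.pow T.k)).mul (h2.pow T.m)).mul (h3.pow T.ℓ))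
  have hK : ∀ c : K, algebraMap A F (algebraMap K A c) = algebraMap K F c :=
    fun c => (IsScalarTower.algebraMap_apply _ _ _ c).symm
  have hq : algebraMap A F (quadric α u) = quadric α fun i => algebraMap A F (u i) :=
    algebraMap_quadric α (IsScalarTower.toAlgHom K A F) u
  refine ⟨algebraMap K A (T.c : K) * (T.P.eval₂ ((algebraMap K A).comp (Rat.castHom K))
        (fun v => match v with
          | Var.u i => u i
          | Var.scale => algebraMap K A α
          | Var.param j => algebraMap K A (β j)) * d), ?_⟩
  have hr : (algebraMap A F).comp ((algebraMap K A).comp (Rat.castHom K)) =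
      (algebraMap K F).comp (Rat.castHom K) := RingHom.ext_rat _ _
  have hv : (fun v : Var => algebraMap A F (match v with
          | Var.u i => u i
          | Var.scale => algebraMap K A α
          | Var.param j => algebraMap K A (β j))) = fun v => match v with
          | Var.u i => algebraMap A F (u i)
          | Var.scale => algebraMap K F α
          | Var.param j => algebraMap K F (β j) := by
    funext v
    cases v with
    | u i => rfl
    | scale => exact hK α
    | param j => exact hK (β j)
  rw [map_mul, map_mul, hd, RatTerm.value, ← div_eq_mul_inv, MvPolynomial.hom_eval₂, hr, hv]
  simp only [map_mul, map_pow, map_sub, map_one, hq, hK]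

theorem exists_ratFun_eq {K A F : Type*} [Field K] [CharZero K] [CommRing A] [Field F]
    [Algebra K A] [Algebra K F] [Algebra A F] [IsScalarTower K A F] {α : K} (hα : α ≠ 0)
    (β : Fin 4 → K) {u : Fin 7 → A} (h1 : IsUnit (u 0)) (h2 : IsUnit (1 - u 0))
    (h3 : IsUnit (quadric α u)) (f : List RatTerm) :
    ∃ y : A, algebraMap A F y = ratFun f α β fun i => algebraMap A F (u i) := by
  induction f with
  | nil => exact ⟨0, by simp [ratFun]⟩
  | cons T f ih =>
    obtain ⟨y, hy⟩ := ih
    obtain ⟨z, hz⟩ := T.exists_value_eq (F := F) hα β h1 h2 h3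
    exact ⟨z + y, by rw [map_add, hy, hz]; simp [ratFun]⟩

/-- The form has coefficients in `A` and differentials of elements of `A`, and the map on
differentials commutes with `d`. -/
theorem map_sigmaTildeAlg {K A F : Type*} [Field K] [CommRing A] [CommRing F] [Algebra K A] [Algebra K F]
    [Algebra A F] [IsScalarTower K A F] (R : ⋀[A]^6 (Ω[A⁄K]) →ₗ[A] ⋀[F]^6 (Ω[F⁄K]))
    (hR : ∀ v, R (exteriorPower.ιMulti A 6 v) =
      exteriorPower.ιMulti F 6 fun i => KaehlerDifferential.map K K A F (v i)) (u : Fin 7 → A) :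
    R (sigmaTildeAlg K u) = sigmaTildeAlg K fun i => algebraMap A F (u i) := by
  rw [sigmaTildeAlg, sigmaTildeAlg, map_smul, map_sum, IsScalarTower.algebraMap_apply K A F,
    algebraMap_smul F (algebraMap K A (1 / 2))]
  refine congrArg _ ?_
  refine Finset.sum_congr rfl fun j _ => ?_
  rw [map_smul, hR, ← algebraMap_smul F]
  simp only [map_mul, map_pow, map_neg, map_one, KaehlerDifferential.map_D]

theorem exists_regular_form {K A F : Type*} [Field K] [CharZero K] [CommRing A] [Field F]
    [Algebra K A] [Algebra K F] [Algebra A F] [IsScalarTower K A F] {α : K} (hα : α ≠ 0)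
    (β : Fin 4 → K) {u : Fin 7 → A} (h1 : IsUnit (u 0)) (h2 : IsUnit (1 - u 0))
    (h3 : IsUnit (quadric α u)) (f : List RatTerm) (R : ⋀[A]^6 (Ω[A⁄K]) →ₗ[A] ⋀[F]^6 (Ω[F⁄K]))
    (hR : ∀ v, R (exteriorPower.ιMulti A 6 v) =
      exteriorPower.ιMulti F 6 fun i => KaehlerDifferential.map K K A F (v i)) :
    ∃ θ : ⋀[A]^6 (Ω[A⁄K]), R θ = ratFun f α β (fun i => algebraMap A F (u i)) •
      sigmaTildeAlg K fun i => algebraMap A F (u i) := by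
  obtain ⟨y, hy⟩ := exists_ratFun_eq (F := F) hα β h1 h2 h3 f
  exact ⟨y • sigmaTildeAlg K u, by
    rw [map_smul, map_sigmaTildeAlg R hR, ← hy, algebraMap_smul]⟩

variable {K : Type*} [Field K] (α : K)

/-- The coordinates as regular functions. -/
noncomputable def uReg (i : Fin 7) : CoordRing α :=
  algebraMap (MvPolynomial (Fin 7) K) (CoordRing α) (MvPolynomial.X i)

/-- The localization inverts this product, and in a commutative ring each factor of a unit is a
unit. -/
theorem isUnit_divisor : IsUnit (uReg α 0 * (1 - uReg α 0) * quadric α (uReg α)) := by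
  have h := IsLocalization.Away.algebraMap_isUnit (S := CoordRing α) (divisorPoly α)
  have e : quadric α (uReg α) = algebraMap (MvPolynomial (Fin 7) K) (CoordRing α)
      (quadric α (MvPolynomial.X : Fin 7 → _)) :=
    (algebraMap_quadric α (IsScalarTower.toAlgHom K (MvPolynomial (Fin 7) K) (CoordRing α))
      (MvPolynomial.X : Fin 7 → _)).symm
  rw [e]
  simp only [divisorPoly, map_mul, map_sub, map_one] at h
  exact h

variable [CharZero K]

theorem regularToRational_ιMulti (v : Fin 6 → Ω[CoordRing α⁄K]) :
    regularToRational α (exteriorPower.ιMulti (CoordRing α) 6 v) =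
      exteriorPower.ιMulti (FunField α) 6 fun i =>
        KaehlerDifferential.map K K (CoordRing α) (FunField α) (v i) := by
  rw [regularToRational, exteriorPower.alternatingMapLinearEquiv_apply_ιMulti]
  rfl

theorem exists_regularToRational_eq (hα : α ≠ 0) (β : Fin 4 → K) (f : List RatTerm) :
    ∃ θ : ⋀[CoordRing α]^6 (Ω[CoordRing α⁄K]),
      regularToRational α θ = ratFun f α β (uFun α) • sigmaTildeAlg K (uFun α) := by
  have hu := isUnit_divisor α
  have h12 := isUnit_of_mul_isUnit_left hu
  exact exists_regular_form hα β (isUnit_of_mul_isUnit_left h12) (isUnit_of_mul_isUnit_right h12)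
    (isUnit_of_mul_isUnit_right hu) f (regularToRational α) (regularToRational_ιMulti α)

end Algebraic

end RobertsonWalker

theorem mainTheorem9 :
    ∃ f : List RobertsonWalker.RatTerm,
      (∀ (J : Set ℝ) (a : ℝ → ℝ), IsOpen J → ContDiffOn ℝ ∞ a J → (∀ t ∈ J, a t ≠ 0) →
        ∀ t ∈ J, ∀ φ₁ φ₂ : ℝ, ∀ η ∈ Set.Ioo (0 : ℝ) (Real.pi / 2),
          (∀ ξ : Fin 6 → ℝ, ξ ≠ 0 →
            RobertsonWalker.b6 a ![t, η, φ₁, φ₂] ξ =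
                ((RobertsonWalker.ratFun f (a t) (fun j : Fin 4 => iteratedDeriv ((j : ℕ) + 1) a t)
                  (RobertsonWalker.uCoord (Fin.cons η ξ)) : ℝ) : ℂ) ∧
            RobertsonWalker.b6Form a t φ₁ φ₂ (Fin.cons η ξ) =
              RobertsonWalker.pullback RobertsonWalker.uCoord
                (RobertsonWalker.omegaForm f (a t)
                  (fun j : Fin 4 => iteratedDeriv ((j : ℕ) + 1) a t)) (Fin.cons η ξ)) ∧
          RobertsonWalker.sphereIntegral (RobertsonWalker.trSymb a ![t, η, φ₁, φ₂]) =
            RobertsonWalker.sphereIntegral (RobertsonWalker.b6 a ![t, η, φ₁, φ₂])) ∧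
      (∀ (K : Type*) [Field K] [CharZero K] (α : K), α ≠ 0 → ∀ β : Fin 4 → K,
        ∃ θ : ⋀[RobertsonWalker.CoordRing α]^6 (Ω[RobertsonWalker.CoordRing α⁄K]),
          RobertsonWalker.regularToRational α θ =
            RobertsonWalker.ratFun f α β (RobertsonWalker.uFun α) •
              RobertsonWalker.sigmaTildeAlg K (RobertsonWalker.uFun α)) := by
  obtain ⟨f, hf⟩ := RobertsonWalker.exists_ratFun_b6
  -- Regularity holds for any list of summands of this shape; the choice of `f` matters only for the
  -- identities over `ℝ`.
  refine ⟨f, ?_, fun K _ _ α hα β => RobertsonWalker.exists_regularToRational_eq α hα β f⟩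
  intro J a hJ ha ha0 t ht φ₁ φ₂ η hη
  have hs : RobertsonWalker.IsScale J a := ⟨hJ, ha, ha0⟩
  refine ⟨fun ξ hξ => ?_, RobertsonWalker.sphereIntegral_b6 hs (by simpa using ht)
    (by simpa using hη)⟩
  have hp : RobertsonWalker.InPatch J ![t, η, φ₁, φ₂] ξ :=
    ⟨by simpa using ht, by simpa using hη, hξ⟩
  have hb := hf J a hs _ ξ hp
  simp only [Matrix.cons_val_zero, Matrix.cons_val_one] at hb
  refine ⟨hb, ?_⟩
  have h1 : Real.sin ((Fin.cons η ξ : Fin 7 → ℝ) 0) ≠ 0 := by simpa using hp.sin_pos.ne'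
  have h2 : Real.cos ((Fin.cons η ξ : Fin 7 → ℝ) 0) ≠ 0 := by simpa using hp.cos_pos.ne'
  rw [RobertsonWalker.pullback_omegaForm f _ _ _ h1 h2, ← hb, RobertsonWalker.b6Form,
    Fin.cons_zero, Fin.tail_cons]
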